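/- **Memory swapping.** Let $N=N_A+N_R+N_B$ with $N_A,N_B\ge 1$, $N_R\ge 0$, and let $H$ be a Hermitian operator on $\mathcal H=(\mathbb C^2)^{\otimes N}$ (a chain of $N$ qubits with computational basis states $|0\rangle,|1\rangle$ at each site) which is the Hamiltonian of an open nearest-neighbour chain, $H=\sum_{n=1}^{N-1}h_{n,n+1}$ with $h_{n,n+1}$ acting on the qubits $n,n+1$ only, and which commutes with the number of excitations $\sum_n|1\rangle_n\langle 1|$. Let $|\boldsymbol n\rangle$ be the basis state with a single excitation, at site $n$, and $f_{n,m}(t)=\langle\boldsymbol n|e^{-iHt}|\boldsymbol m\rangle$. Assume that $f_{1,N}(s)\ne 0$ for some real $s$. *Protocol.* Let $C$ consist of the last $N_B$ qubits (Bob) and $\bar C$ of the first $N_A+N_R$ qubits, and let $d=2^N$. Write $|0\rangle$ for the state of any of the systems below in which all qubits are in the state $|0\rangle$. Fix a time interval $t\in\mathbb R$ and put $U=e^{-iHt}$. For $L\in\mathbb N$ let $M=M_1\otimes\dots\otimes M_L$ be a memory of $L$ registers, each isomorphic with $C$; let $S_\ell$ be the swap of $C$ with $M_\ell$, and $W=S_LU\,S_{L-1}U\cdots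 S_1U$. Let $\tau(\rho)=\operatorname{tr}_C[U(\rho\otimes|0\rangle_C\langle 0|)U^\dagger]$, a map on the density matrices of $\bar C$. For a unit vector $\psi\in\mathcal H$ let $\sqrt{\eta(\psi)}\,|\phi(\psi)\rangle_M$, with $\eta(\psi)\ge0$ and $\phi(\psi)$ a unit vector (for definiteness $\phi(\psi)=0$ if $\eta(\psi)=0$), be the component ${}_{C\bar C}\langle 0|\,W\,|\psi\rangle_{C\bar C}|0\rangle_M$. Let $(\psi_k)$ be an orthonormal basis of $\mathcal H$, $\eta_0=\min_k\eta(\psi_k)$, and let $J$ be a linear isometry of $\mathcal H$ into the Hilbert space of $M$ (it exists if $LN_B\ge N$). Let $D=\sum_k|\phi(\psi_k)\rangle\langle J\psi_k|$, and let $V$ be the unitary factor of a polar decomposition $D=PV$ ($P\ge 0$, $V$ unitary). The fidelities of reading and of writing are $$F_r(\psi)=\langle J\psi|V^\dagger\operatorname{tr}_{C\bar C}\!\big[W(|\psi\rangle\langle\psi|\otimes|0\rangle_M\langle 0|)W^\dagger\big]V|J\psi\rangle,$$ $$F_w(\psi)=\langle\psi|\operatorname{tr}_{M}\!\big[W^\dagger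 V(|0\rangle_{C\bar C}\langle 0|\otimes|J\psi\rangle\langle J\psi|)V^\dagger W\big]|\psi\rangle .$$ Call $t$ non-resonant if $e^{-iEt}\ne e^{-iE't}$ for any two distinct eigenvalues $E,E'$ of $H$. Then: 1. All but countably many $t\in\mathbb R$ are non-resonant. 2. For every non-resonant $t$ the map $\tau$ is mixing toward the pure state $|0\rangle_{\bar C}\langle 0|$: $\tau^n(\rho)\to|0\rangle\langle0|$ for every density matrix $\rho$ of $\bar C$. 3. For all $t$, $L$, $(\psi_k)$ and $J$ as above, such a $V$ exists, and for every such $V$ and every unit vector $\psi\in\mathcal H$ $$F_r(\psi)\ \ge\ \eta_0-10\,d\,(1-\eta_0)^{1/4},\qquad F_w(\psi)\ \ge\ \eta_0-10\,d\,(1-\eta_0)^{1/4}.$$ 4. For every non-resonant $t$ and every $\varepsilon>0$ there is an $L_0$ such that for all $L\ge L_0$ isometries $J$ exist, and for all $(\psi_k)$, $J$ and $V$ as above: $\eta_0\ge 1-\varepsilon$; $F_r(\psi)\ge 1-\varepsilon$ and $F_w(\psi)\ge1-\varepsilon$ for all unit vectors $\psi\in\mathcal H$; in particular every unit vector $\psi_A$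 of the first $N_A$ qubits (Alice) is transferred with fidelity $F_r(|\psi_A\rangle\otimes|0\rangle)\ge1-\varepsilon$. -/

import Mathlib

open Matrix Filter Topology
open scoped Kronecker ComplexOrder

/-- Computational basis labels of `n` qubits. -/
abbrev Cfg (n : ℕ) : Type := Fin n → Fin 2

/-- The Hilbert space with orthonormal basis labelled by `X`. -/
abbrev Ket (X : Type*) [Fintype X] : Type _ := EuclideanSpace ℂ X

/-- Operators, as matrices in the computational basis. -/
abbrev Op (X : Type*) : Type _ := Matrix X X ℂ

noncomputable section

/-! ### Spin chains -/

section Chain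

variable {n : ℕ}

/-- The observable "number of excitations", `∑ i, |1⟩⟨1|_i`. -/
def numberOp (n : ℕ) : Op (Cfg n) :=
  Matrix.diagonal fun x => ∑ i, ((x i : ℕ) : ℂ)

/-- The two-qubit operator `h` acting on the qubits `i`, `j` and as the identity elsewhere. -/
def bondOp (i j : Fin n) (h : Op (Fin 2 × Fin 2)) : Op (Cfg n) :=
  Matrix.of fun x y =>
    if ∀ k, k ≠ i → k ≠ j → x k = y k then h (x i, x j) (y i, y j) else 0

/-- Nearest-neighbour interactions on an open chain: `H = ∑ h_{i,i+1}`. -/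
def IsNearestNeighbour (H : Op (Cfg n)) : Prop :=
  ∃ h : Fin n → Op (Fin 2 × Fin 2),
    H = ∑ i : Fin n, ∑ j : Fin n, if (i : ℕ) + 1 = (j : ℕ) then bondOp i j (h i) else 0

/-- The time evolution `exp(-iHt)`. -/
def evolution {X : Type*} [Fintype X] [DecidableEq X] (H : Op X) (t : ℝ) : Op X :=
  NormedSpace.exp ((-(Complex.I * (t : ℂ))) • H)

/-- The state with exactly one excitation, located at the qubit `k`. -/
def oneExcitation (k : Fin n) : Cfg n := Pi.single k 1

/-- The transfer function `f_{k,l}(t) = ⟨k| exp(-iHt) |l⟩` of the one-excitation sector. -/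
def transferFunction (H : Op (Cfg n)) (k l : Fin n) (t : ℝ) : ℂ :=
  evolution H t (oneExcitation k) (oneExcitation l)

/-- Distinct energies of `H` have distinct phases `exp(-iEt)`, i.e. the eigenvectors of
`exp(-iHt)` are those of `H`. -/
def NonResonant {X : Type*} [Fintype X] [DecidableEq X] (H : Op X) (t : ℝ) : Prop :=
  Set.InjOn (fun E : ℂ => Complex.exp (-(Complex.I * (t : ℂ)) * E)) (spectrum ℂ H)

/-- The evolution of a chain of `a + b` qubits, on the tensor product of the Hilbert spaces of its
first `a` and its last `b` qubits. -/
def splitEvolution (a b : ℕ) (H : Op (Cfg (a + b))) (t : ℝ) : Op (Cfg a × Cfg b) :=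
  (evolution H t).submatrix (fun p => Fin.append p.1 p.2) (fun p => Fin.append p.1 p.2)

end Chain

/-! ### States -/

section States

variable {X Y : Type*} [Fintype X] [DecidableEq X] [Fintype Y] [DecidableEq Y]

/-- The basis vector `|0⟩`. -/
def ketZero (X : Type*) [Fintype X] [DecidableEq X] [Zero X] : Ket X := EuclideanSpace.single 0 1

/-- The tensor product `|v⟩ ⊗ |w⟩`. -/
def ketTensor (v : Ket X) (w : Ket Y) : Ket (X × Y) := WithLp.toLp 2 fun p => v p.1 * w p.2

/-- The operator `|v⟩⟨w|`. -/
def ketBra (v w : Ket X) : Op X := Matrix.vecMulVec v.ofLp (star w.ofLp)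

/-- The matrix element `⟨v|A|v⟩`. -/
def expectation (A : Op X) (v : Ket X) : ℂ := star v.ofLp ⬝ᵥ (A *ᵥ v.ofLp)

/-- Trace over the first factor. -/
def traceLeft (A : Op (X × Y)) : Op Y := Matrix.of fun i j => ∑ x, A (x, i) (x, j)

/-- Trace over the second factor. -/
def traceRight (A : Op (X × Y)) : Op X := Matrix.of fun i j => ∑ y, A (i, y) (j, y)

/-- The set of density matrices. -/
def densityMatrices (X : Type*) [Fintype X] : Set (Op X) :=
  {ρ | ρ.PosSemidef ∧ ρ.trace = 1}

/-- `τ` is a map on density matrices all of whose orbits converge to the density matrix `σ`. -/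
def IsMixingToward (τ : Op X → Op X) (σ : Op X) : Prop :=
  Set.MapsTo τ (densityMatrices X) (densityMatrices X) ∧ σ ∈ densityMatrices X ∧
    ∀ ρ ∈ densityMatrices X, Tendsto (fun n : ℕ => τ^[n] ρ) atTop (𝓝 σ)

end States

/-! ### The memory swapping protocol

`X` labels the uncontrolled part of the system, `Y` the controlled part, and the memory consists
of `L` registers, each isomorphic with the controlled part. -/

section Protocol

variable {X Y : Type*} [Fintype X] [DecidableEq X] [Zero X] [Fintype Y] [DecidableEq Y] [Zero Y]
variable {L : ℕ}

/-- The reduced map `τ(ρ) = tr_Y [U (ρ ⊗ |0⟩⟨0|) U†]` on the uncontrolled part. -/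
def reducedMap (U : Op (X × Y)) (ρ : Op X) : Op X :=
  traceRight (U * (ρ ⊗ₖ ketBra (ketZero Y) (ketZero Y)) * Uᴴ)

/-- The action of the swap of the controlled part with the memory register `l` on basis labels. -/
def swapLabel (l : Fin L) (p : (X × Y) × (Fin L → Y)) : (X × Y) × (Fin L → Y) :=
  ((p.1.1, p.2 l), Function.update p.2 l p.1.2)

/-- The swap `S_l` of the controlled part with the memory register `l`. -/
def swapOp (l : Fin L) : Op ((X × Y) × (Fin L → Y)) :=
  Matrix.of fun p q => if p = swapLabel l q then 1 else 0

/-- The first `k` rounds `S_k U ⋯ S_2 U S_1 U` of the protocol (all `L` of them if `L ≤ k`). -/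
def protocolSteps (L : ℕ) (U : Op (X × Y)) : ℕ → Op ((X × Y) × (Fin L → Y))
  | 0 => 1
  | k + 1 =>
    if h : k < L then swapOp ⟨k, h⟩ * (U ⊗ₖ (1 : Op (Fin L → Y))) * protocolSteps L U k
    else protocolSteps L U k

/-- The protocol `W = S_L U ⋯ S_2 U S_1 U`. -/
def protocol (L : ℕ) (U : Op (X × Y)) : Op ((X × Y) × (Fin L → Y)) := protocolSteps L U L

/-- The memory vector `√η |φ⟩`, the component of `W (|ψ⟩ ⊗ |0⟩)` along `|0⟩` of the system. -/
def transferred (L : ℕ) (U : Op (X × Y)) (ψ : Ket (X × Y)) : Ket (Fin L → Y) :=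
  WithLp.toLp 2 fun m =>
    (protocol L U *ᵥ (ketTensor ψ (ketZero (Fin L → Y))).ofLp) (0, m)

/-- The transferred weight `η` of `|ψ⟩`. -/
def weight (L : ℕ) (U : Op (X × Y)) (ψ : Ket (X × Y)) : ℝ := ‖transferred L U ψ‖ ^ 2

/-- The normalised memory vector `|φ⟩` (the zero vector if `η = 0`). -/
def memoryKet (L : ℕ) (U : Op (X × Y)) (ψ : Ket (X × Y)) : Ket (Fin L → Y) :=
  (((Real.sqrt (weight L U ψ))⁻¹ : ℝ) : ℂ) • transferred L U ψ

/-- `η₀`, the minimal transferred weight of the vectors of an orthonormal basis. -/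
def minWeight (L : ℕ) (U : Op (X × Y)) (b : OrthonormalBasis (X × Y) ℂ (Ket (X × Y))) : ℝ :=
  ⨅ k, weight L U (b k)

/-- The operator `D` on the memory with `D J|ψ_k⟩ = |φ_k⟩` for the basis vectors `|ψ_k⟩`, and
`D = 0` on the orthogonal complement of the range of `J`. The isometry `J` says by which memory
states the states of the system are represented. -/
def codingOp (L : ℕ) (U : Op (X × Y)) (b : OrthonormalBasis (X × Y) ℂ (Ket (X × Y)))
    (J : Ket (X × Y) →ₗᵢ[ℂ] Ket (Fin L → Y)) : Op (Fin L → Y) :=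
  ∑ k, ketBra (memoryKet L U (b k)) (J (b k))

/-- `V` is the unitary factor of a polar decomposition `D = P V`. -/
def IsPolarUnitary {Z : Type*} [Fintype Z] [DecidableEq Z] (D V : Op Z) : Prop :=
  V ∈ Matrix.unitaryGroup Z ℂ ∧ ∃ P : Op Z, P.PosSemidef ∧ D = P * V

/-- The fidelity of reading: the system starts in `|ψ⟩` and the memory in `|0⟩`; apply `W`, then
`V†` on the memory, and compare the state of the memory with `J|ψ⟩`. -/
def readFidelity (U : Op (X × Y)) (J : Ket (X × Y) →ₗᵢ[ℂ] Ket (Fin L → Y))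
    (V : Op (Fin L → Y)) (ψ : Ket (X × Y)) : ℝ :=
  (expectation
    (Vᴴ *
      traceLeft (protocol L U *
        (ketBra ψ ψ ⊗ₖ ketBra (ketZero (Fin L → Y)) (ketZero (Fin L → Y))) * (protocol L U)ᴴ) *
      V) (J ψ)).re

/-- The fidelity of writing: the system starts in `|0⟩` and the memory in `J|ψ⟩`; apply `V` on the
memory, then `W†`, and compare the state of the system with `|ψ⟩`. -/
def writeFidelity (U : Op (X × Y)) (J : Ket (X × Y) →ₗᵢ[ℂ] Ket (Fin L → Y))
    (V : Op (Fin L → Y)) (ψ : Ket (X × Y)) : ℝ :=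
  (expectation
    (traceRight ((protocol L U)ᴴ *
      (ketBra (ketZero (X × Y)) (ketZero (X × Y)) ⊗ₖ (V * ketBra (J ψ) (J ψ) * Vᴴ)) *
      protocol L U)) ψ).re

end Protocol

/-- The chain state in which the first `a` qubits (Alice) are in the state `ψ` and the following
`r` qubits and the last `b` qubits (Bob) are in the state `|0⟩`. -/
def aliceKet (a r b : ℕ) (ψ : Ket (Cfg a)) : Ket (Cfg (a + r) × Cfg b) :=
  ketTensor
    (WithLp.toLp 2 fun x : Cfg (a + r) =>
      ketTensor ψ (ketZero (Cfg r)) (fun i => x (Fin.castAdd r i), fun i => x (Fin.natAdd a i)))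
    (ketZero (Cfg b))

end

/-! ### Time evolution of a Hermitian operator -/

section Evolution

variable {X : Type*} [Fintype X] [DecidableEq X]

/-! Mixing rests on a Lyapunov function. By conservation, one application of the reduced map lowers
the expected number of excitations by exactly the expected number found on Bob's side. If nothing is
lost for ever, the vectors that never leak, taken orthogonal to `|0⟩`, form a subspace invariant
under the Kraus operator `⟨0|U|0⟩`. If nonzero, it contains an eigenvector of this operator, hence
`U` has an eigenvector `|w⟩ ⊗ |0⟩` (`eq_zero_of_forall_kraus_eq_zero`). For a non-resonant time this
is an eigenvector of `H`. In a nearest-neighbour chain with nonzero hopping, its empty end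
propagates inward bond by bond and leaves only multiples of `|0⟩` (`eigenvector_apply_eq_zero`). The
hopping is nonzero since a dead bond would block the transfer between the ends. Compactness of the
density matrices turns strictness into convergence.

From the second round on, the system evolves by the reduced map, so the transferred weight of each
state tends to `1`. The lost weight is a quadratic form `‖R ψ‖ ^ 2`, dominated by its sum over any
orthonormal basis, which gives uniformity in the state.

For the fidelities, let `T` send `ψ` to its memory component along `|0⟩` of the system. Both
fidelities are at least `|⟨V J ψ, T ψ⟩| ^ 2`. Since `D` is close to `T J†` and `D = P V`, the vector
`P V J ψ` is close to `T ψ` and has norm close to `1`, while `P` has norm hardly above `1`. So `P`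
almost fixes `V J ψ` (`norm_inner_sq_ge_of_polar`). The loss obtained is linear in `1 - η₀`, which
implies the fourth-root bound. -/

theorem apply_eq_zero_of_commute_diagonal {A : Op X} {d : X → ℂ} (h : Commute A (diagonal d))
    {x y : X} (hxy : d x ≠ d y) : A x y = 0 := by
  have h1 := congrFun (congrFun h.eq x) y
  rw [mul_diagonal, diagonal_mul] at h1
  have h2 : (d x - d y) * A x y = 0 := by linear_combination -h1
  exact (mul_eq_zero.mp h2).resolve_left (sub_ne_zero.mpr hxy)

theorem commute_diagonal_of_apply_eq_zero {A : Op X} {d : X → ℂ}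
    (h : ∀ x y, d x ≠ d y → A x y = 0) : Commute A (diagonal d) := by
  ext x y
  rw [mul_diagonal, diagonal_mul]
  by_cases hd : d x = d y
  · rw [hd, mul_comm]
  · rw [h x y hd, zero_mul, mul_zero]

theorem Commute.evolution_left {H A : Op X} (h : Commute H A) (t : ℝ) :
    Commute (evolution H t) A :=
  (h.smul_left _).exp_left

theorem evolution_eq_conj_diagonal {H : Op X} (hH : H.IsHermitian) (t : ℝ) :
    evolution H t = (hH.eigenvectorUnitary : Op X) *
      diagonal (fun j => Complex.exp (-(Complex.I * (t : ℂ)) * (hH.eigenvalues j : ℂ))) *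
        star (hH.eigenvectorUnitary : Op X) := by
  set Q : Op X := (hH.eigenvectorUnitary : Op X) with hQ
  have hQu : star Q * Q = 1 := Unitary.coe_star_mul_self hH.eigenvectorUnitary
  have hQu' : Q * star Q = 1 := Unitary.coe_mul_star_self hH.eigenvectorUnitary
  have hinv : Q⁻¹ = star Q := inv_eq_left_inv hQu
  have hunit : IsUnit Q := IsUnit.of_mul_eq_one _ hQu'
  have hs : H = Q * diagonal (fun j => (hH.eigenvalues j : ℂ)) * star Q := by
    conv_lhs => rw [hH.spectral_theorem, Unitary.conjStarAlgAut_apply]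
    rfl
  have h1 : (-(Complex.I * (t : ℂ))) • H =
      Q * diagonal (fun j => -(Complex.I * (t : ℂ)) * (hH.eigenvalues j : ℂ)) * Q⁻¹ := by
    conv_lhs => rw [hs]
    rw [hinv, ← smul_mul_assoc, ← mul_smul_comm, ← diagonal_smul]
    rfl
  rw [evolution, h1, Matrix.exp_conj _ _ hunit, Matrix.exp_diagonal, hinv]
  congr 3
  funext j
  rw [Pi.coe_exp, Complex.exp_eq_exp_ℂ]

theorem star_evolution_mul_self {H : Op X} (hH : H.IsHermitian) (t : ℝ) :
    (evolution H t)ᴴ * evolution H t = 1 := by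
  have hQu : star (hH.eigenvectorUnitary : Op X) * (hH.eigenvectorUnitary : Op X) = 1 :=
    Unitary.coe_star_mul_self hH.eigenvectorUnitary
  have hQu' : (hH.eigenvectorUnitary : Op X) * star (hH.eigenvectorUnitary : Op X) = 1 :=
    Unitary.coe_mul_star_self hH.eigenvectorUnitary
  rw [evolution_eq_conj_diagonal hH]
  set Q : Op X := (hH.eigenvectorUnitary : Op X)
  rw [star_eq_conjTranspose] at *
  rw [conjTranspose_mul, conjTranspose_mul, conjTranspose_conjTranspose, diagonal_conjTranspose]
  set d : X → ℂ := fun j => Complex.exp (-(Complex.I * (t : ℂ)) * (hH.eigenvalues j : ℂ)) with hd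
  have hdd : diagonal (star d) * diagonal d = (1 : Op X) := by
    rw [diagonal_mul_diagonal, ← diagonal_one]
    congr 1
    funext j
    simp only [hd, Pi.star_apply, RCLike.star_def]
    rw [← Complex.exp_conj, ← Complex.exp_add]
    simp
  calc Q * (diagonal (star d) * Qᴴ) * (Q * diagonal d * Qᴴ)
      = Q * (diagonal (star d) * (Qᴴ * Q) * diagonal d) * Qᴴ := by simp only [Matrix.mul_assoc]
    _ = 1 := by rw [hQu, Matrix.mul_one, hdd, Matrix.mul_one, hQu']

/-- For a non-resonant time, the eigenvectors of the evolution are eigenvectors of `H`. -/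
theorem NonResonant.exists_eigenvalue {H : Op X} (hH : H.IsHermitian) {t : ℝ}
    (ht : NonResonant H t) {v : X → ℂ} {μ : ℂ} (hv : evolution H t *ᵥ v = μ • v) :
    ∃ E : ℂ, H *ᵥ v = E • v := by
  have hQu : star (hH.eigenvectorUnitary : Op X) * (hH.eigenvectorUnitary : Op X) = 1 :=
    Unitary.coe_star_mul_self hH.eigenvectorUnitary
  have hQu' : (hH.eigenvectorUnitary : Op X) * star (hH.eigenvectorUnitary : Op X) = 1 :=
    Unitary.coe_mul_star_self hH.eigenvectorUnitary
  have hs : H = (hH.eigenvectorUnitary : Op X) * diagonal (fun j => (hH.eigenvalues j : ℂ)) *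
      star (hH.eigenvectorUnitary : Op X) := by
    conv_lhs => rw [hH.spectral_theorem, Unitary.conjStarAlgAut_apply]
    rfl
  have hspec : ∀ j, (hH.eigenvalues j : ℂ) ∈ spectrum ℂ H := fun j => by
    rw [hH.spectrum_eq_image_range]
    exact ⟨_, ⟨j, rfl⟩, rfl⟩
  rw [evolution_eq_conj_diagonal hH] at hv
  set Q : Op X := (hH.eigenvectorUnitary : Op X)
  set w : X → ℂ := star Q *ᵥ v with hw
  have hvw : v = Q *ᵥ w := by rw [hw, mulVec_mulVec, hQu', one_mulVec]
  have hdw : ∀ j, Complex.exp (-(Complex.I * (t : ℂ)) * (hH.eigenvalues j : ℂ)) * w j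
      = μ * w j := by
    have h2 := congrArg (fun u => star Q *ᵥ u) hv
    simp only [mulVec_smul] at h2
    rw [← mulVec_mulVec, ← mulVec_mulVec, ← hw, mulVec_mulVec, hQu, one_mulVec] at h2
    intro j
    have h3 := congrFun h2 j
    rwa [mulVec_diagonal] at h3
  -- In the eigenbasis of `H`, every nonzero coordinate of the vector belongs to the phase `μ`;
  -- non-resonance makes the corresponding energies equal. For the zero vector any `E` serves.
  have key : ∃ E : ℂ, ∀ j, (hH.eigenvalues j : ℂ) * w j = E * w j := by
    by_cases hz : ∃ k, w k ≠ 0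
    · obtain ⟨k, hk⟩ := hz
      refine ⟨hH.eigenvalues k, fun j => ?_⟩
      by_cases hj : w j = 0
      · simp [hj]
      · have h1 := mul_right_cancel₀ hk (hdw k)
        have h2 := mul_right_cancel₀ hj (hdw j)
        rw [ht (hspec j) (hspec k) (h2.trans h1.symm)]
    · push Not at hz
      exact ⟨0, fun j => by simp [hz j]⟩
  obtain ⟨E, hE⟩ := key
  refine ⟨E, ?_⟩
  have h4 : diagonal (fun j => (hH.eigenvalues j : ℂ)) *ᵥ w = E • w := by
    funext j
    rw [mulVec_diagonal]
    exact hE j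
  conv_lhs => rw [hs]
  rw [← mulVec_mulVec, ← mulVec_mulVec, ← hw, h4, mulVec_smul, ← hvw]

/-- Equal phases force `t * (E' - E)` into `2πℤ`, so `t` is determined by an integer. The real part
appears only because the energies are typed as complex numbers. -/
theorem countable_setOf_exp_eq {E E' : ℂ} (hE : E ≠ E') :
    {t : ℝ | Complex.exp (-(Complex.I * (t : ℂ)) * E) =
      Complex.exp (-(Complex.I * (t : ℂ)) * E')}.Countable := by
  have hsub : {t : ℝ | Complex.exp (-(Complex.I * (t : ℂ)) * E) =
      Complex.exp (-(Complex.I * (t : ℂ)) * E')} ⊆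
      Set.range fun n : ℤ => (2 * Real.pi * n * (E' - E)⁻¹ : ℂ).re := by
    intro t ht
    obtain ⟨n, hn⟩ := Complex.exp_eq_exp_iff_exists_int.mp ht
    refine ⟨n, ?_⟩
    have h0 : E' - E ≠ 0 := sub_ne_zero.mpr hE.symm
    have h1 : (t : ℂ) * (E' - E) = 2 * Real.pi * n := by
      apply mul_left_cancel₀ Complex.I_ne_zero
      linear_combination hn
    simp only
    rw [← h1, mul_assoc, mul_inv_cancel₀ h0, mul_one, Complex.ofReal_re]
  exact (Set.countable_range _).mono hsub

/-- Only countably many times are resonant. -/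
theorem countable_setOf_not_nonResonant (H : Op X) : {t : ℝ | ¬ NonResonant H t}.Countable := by
  have hfin : (spectrum ℂ H).Finite := Matrix.finite_spectrum H
  have hsub : {t : ℝ | ¬ NonResonant H t} ⊆ ⋃ E ∈ spectrum ℂ H, ⋃ E' ∈ spectrum ℂ H \ {E},
      {t : ℝ | Complex.exp (-(Complex.I * (t : ℂ)) * E) =
        Complex.exp (-(Complex.I * (t : ℂ)) * E')} := by
    intro t ht
    simp only [Set.mem_ofPred_eq, NonResonant, Set.InjOn] at ht
    push Not at ht
    obtain ⟨E, hE, E', hE', h, hne⟩ := ht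
    simp only [Set.mem_iUnion]
    exact ⟨E, hE, E', ⟨hE', fun h => hne h.symm⟩, h⟩
  refine Set.Countable.mono hsub (hfin.countable.biUnion fun E _ =>
    (hfin.countable.mono Set.sdiff_subset).biUnion fun E' hE' => ?_)
  exact countable_setOf_exp_eq fun h => hE'.2 h.symm

end Evolution

/-! ### Eigenvectors of a nearest-neighbour chain -/

section Chain

variable {n : ℕ}

/-- The number of excitations of a basis state. -/
def excitations (x : Cfg n) : ℕ := ∑ i, (x i : ℕ)

theorem excitations_lt {x y : Cfg n} (hle : ∀ k, x k ≤ y k) {k : Fin n} (hk : x k < y k) :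
    excitations x < excitations y :=
  Finset.sum_lt_sum (fun i _ => hle i) ⟨k, Finset.mem_univ _, hk⟩

theorem excitations_eq_zero_iff {x : Cfg n} : excitations x = 0 ↔ x = 0 := by
  simp only [excitations, Finset.sum_eq_zero_iff, Finset.mem_univ, true_imp_iff, funext_iff]
  exact forall_congr' fun i => Fin.val_eq_zero_iff

theorem apply_eq_zero_of_excitations_ne {A : Op (Cfg n)} (h : Commute A (numberOp n))
    {x y : Cfg n} (hxy : excitations x ≠ excitations y) : A x y = 0 := by
  refine apply_eq_zero_of_commute_diagonal h fun h1 => hxy ?_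
  simp only [excitations]
  exact_mod_cast h1

theorem excitations_oneExcitation (k : Fin n) : excitations (oneExcitation k) = 1 := by
  have h : ∀ i, ((oneExcitation k i : Fin 2) : ℕ) = if i = k then 1 else 0 := fun i => by
    by_cases hi : i = k
    · subst hi; simp [oneExcitation]
    · simp [oneExcitation, hi]
  simp [excitations, h]

theorem eq_oneExcitation_of_excitations_eq_one {x : Cfg n} (hx : excitations x = 1) :
    ∃ k, x = oneExcitation k := by
  obtain ⟨k, hk⟩ : ∃ k, x k ≠ 0 := by
    by_contra! h
    have : excitations x = 0 := excitations_eq_zero_iff.mpr (funext h)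
    omega
  refine ⟨k, ?_⟩
  have hle : ∀ i, oneExcitation k i ≤ x i := fun i => by
    by_cases hi : i = k
    · subst hi
      simp only [oneExcitation, Pi.single_eq_same]
      omega
    · simp [oneExcitation, hi]
  by_contra hne
  obtain ⟨i, hi⟩ := Function.ne_iff.mp hne
  have := excitations_lt hle (lt_of_le_of_ne (hle i) (Ne.symm hi))
  rw [excitations_oneExcitation, hx] at this
  omega

/-- A non-vanishing matrix element of a nearest-neighbour operator changes the state of two
neighbouring qubits only. -/
theorem IsNearestNeighbour.exists_bond {H : Op (Cfg n)} (hnn : IsNearestNeighbour H)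
    {x y : Cfg n} (hxy : H x y ≠ 0) :
    ∃ i j : Fin n, (i : ℕ) + 1 = j ∧ ∀ k, k ≠ i → k ≠ j → x k = y k := by
  obtain ⟨h, rfl⟩ := hnn
  by_contra! hcon
  apply hxy
  simp only [Matrix.sum_apply]
  refine Finset.sum_eq_zero fun i _ => Finset.sum_eq_zero fun j _ => ?_
  split_ifs with hij
  · obtain ⟨k, hk1, hk2, hk3⟩ := hcon i j hij
    simp only [bondOp, of_apply]
    exact if_neg fun hall => hk3 (hall k hk1 hk2)
  · rfl

/-- The amplitude with which an excitation hops from a qubit to the next one does not depend on the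
state of the other qubits. -/
theorem IsNearestNeighbour.exists_hopping {H : Op (Cfg n)} (hnn : IsNearestNeighbour H)
    {l m : Fin n} (hlm : (l : ℕ) + 1 = m) :
    ∃ c : ℂ, ∀ y : Cfg n, y l = 1 → y m = 0 → H (y ∘ Equiv.swap l m) y = c := by
  obtain ⟨h, rfl⟩ := hnn
  refine ⟨h l (0, 1) (1, 0), fun y hyl hym => ?_⟩
  have hxl : (y ∘ Equiv.swap l m) l = 0 := by simp [hym]
  have hxm : (y ∘ Equiv.swap l m) m = 1 := by simp [hyl]
  simp only [Matrix.sum_apply]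
  rw [Finset.sum_eq_single l, Finset.sum_eq_single m]
  · rw [if_pos hlm]
    simp only [bondOp, of_apply]
    rw [if_pos, hxl, hxm, hyl, hym]
    intro k hk1 hk2
    simp [Equiv.swap_apply_of_ne_of_ne hk1 hk2]
  · intro j _ hj
    rw [if_neg fun h1 => hj (Fin.ext (by omega))]
    rfl
  · simp
  -- Any other bond misses `l` or `m`, and the two configurations differ at both, so its term
  -- vanishes. A bond ending at `l` misses `m`; every remaining one misses `l`.
  · intro i _ hi
    refine Finset.sum_eq_zero fun j _ => ?_
    split_ifs with hij
    · simp only [bondOp, of_apply]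
      refine if_neg fun hall => ?_
      by_cases hlj : l = j
      · have h1 := hall m (fun h => by subst h; omega) (fun h => by subst h; subst hlj; omega)
        rw [hxm, hym] at h1
        exact absurd h1 (by decide)
      · have h1 := hall l (Ne.symm hi) hlj
        rw [hxl, hyl] at h1
        exact absurd h1 (by decide)
    · rfl
  · simp

theorem oneExcitation_comp_swap (l m : Fin n) :
    oneExcitation l ∘ Equiv.swap l m = oneExcitation m := by
  funext k
  by_cases hk : k = m
  · subst hk; simp [oneExcitation]
  · simp only [Function.comp, oneExcitation, Pi.single_apply, if_neg hk]
    refine if_neg fun h => hk ?_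
    rw [Equiv.swap_apply_eq_iff] at h
    simpa using h

/-- If an excitation is transferred from the last qubit to the first one, then it can hop over each
of the bonds. -/
theorem hopping_ne_zero {H : Op (Cfg n)} (hH : H.IsHermitian) (hnn : IsNearestNeighbour H)
    (hcons : Commute H (numberOp n)) {s : ℝ} {first last : Fin n}
    (hs : transferFunction H first last s ≠ 0) {l m : Fin n} (hlm : (l : ℕ) + 1 = m)
    (hfirst : first ≤ l) (hlast : m ≤ last) :
    H (oneExcitation m) (oneExcitation l) ≠ 0 := by
  intro h0
  classical
  -- If the bond were dead, the span of the one-excitation states up to `l` would be invariant under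
  -- `H`, hence under the evolution, and the amplitude between `first` and `last` would vanish.
  let p : Cfg n → Prop := fun x => ∃ j, j ≤ l ∧ x = oneExcitation j
  have hinj : ∀ {i j : Fin n}, oneExcitation i = oneExcitation j → i = j := fun {i j} h => by
    by_contra hne
    have := congrFun h i
    simp [oneExcitation, hne] at this
  have hpx : ∀ x y, ¬ p x → p y → H x y = 0 := by
    rintro x _ hx ⟨j, hj, rfl⟩
    by_contra hxy
    have he : excitations x = 1 := by
      by_contra hne
      exact hxy (apply_eq_zero_of_excitations_ne hcons
        (by rwa [excitations_oneExcitation]))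
    obtain ⟨k, rfl⟩ := eq_oneExcitation_of_excitations_eq_one he
    have hk : l < k := by
      by_contra hk
      exact hx ⟨k, not_lt.mp hk, rfl⟩
    have hjk : j ≠ k := (lt_of_le_of_lt hj hk).ne
    obtain ⟨i, i', hi, hall⟩ := hnn.exists_bond hxy
    have h1 : k = i ∨ k = i' := by
      by_contra! hcon
      have := hall k hcon.1 hcon.2
      simp [oneExcitation, hjk.symm] at this
    have h2 : j = i ∨ j = i' := by
      by_contra! hcon
      have := hall j hcon.1 hcon.2
      simp [oneExcitation, hjk] at this
    have hjl : j = l := by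
      apply Fin.ext
      rcases h1 with rfl | rfl <;> rcases h2 with rfl | rfl <;>
        simp only [Fin.lt_def, Fin.le_def] at * <;> omega
    have hkm : k = m := by
      apply Fin.ext
      rcases h1 with rfl | rfl <;> rcases h2 with rfl | rfl <;>
        simp only [Fin.lt_def, Fin.le_def] at * <;> omega
    subst hjl hkm
    exact hxy h0
  have hcomm : Commute H (diagonal fun x => if p x then (1 : ℂ) else 0) := by
    refine commute_diagonal_of_apply_eq_zero fun x y hxy => ?_
    by_cases hx : p x <;> by_cases hy : p y
    · simp [hx, hy] at hxy
    · rw [← hH.apply, hpx y x hy hx, star_zero]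
    · exact hpx x y hx hy
    · simp [hx, hy] at hxy
  refine hs (apply_eq_zero_of_commute_diagonal (hcomm.evolution_left s) ?_)
  have h1 : p (oneExcitation first) := ⟨first, hfirst, rfl⟩
  have h2 : ¬ p (oneExcitation last) := by
    rintro ⟨j, hj, h⟩
    have := hinj h
    subst this
    simp only [Fin.le_def] at *
    omega
  simp [h1, h2]

/-- An eigenvector of a chain with non-vanishing hopping amplitudes, in which the qubits from some
position on are not excited, is a multiple of `|0⟩`. -/
theorem eigenvector_apply_eq_zero {H : Op (Cfg n)} (hnn : IsNearestNeighbour H)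
    (hcons : Commute H (numberOp n))
    (hhop : ∀ l m : Fin n, (l : ℕ) + 1 = m → H (oneExcitation m) (oneExcitation l) ≠ 0)
    {v : Cfg n → ℂ} {E : ℂ} (hv : H *ᵥ v = E • v) {a : ℕ} (ha : a < n)
    (hva : ∀ y : Cfg n, (∃ k : Fin n, a ≤ k ∧ y k ≠ 0) → v y = 0) {y : Cfg n} (hy : y ≠ 0) :
    v y = 0 := by
  -- The empty region is enlarged by one site at a time; at `d = a` it is the whole chain.
  suffices hS : ∀ d ≤ a, ∀ y : Cfg n, (∃ k : Fin n, a - d ≤ k ∧ y k ≠ 0) → v y = 0 by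
    obtain ⟨k, hk⟩ := Function.ne_iff.mp hy
    exact hS a le_rfl y ⟨k, by omega, hk⟩
  intro d
  induction d with
  | zero => intro _; simpa using hva
  | succ d ih =>
    intro hd y ⟨k, hk, hyk⟩
    by_cases hlarge : ∃ k : Fin n, a - d ≤ k ∧ y k ≠ 0
    · exact ih (by omega) y hlarge
    push Not at hlarge
    have hkl : (k : ℕ) + 1 = a - d := by
      by_contra hne
      exact hyk (hlarge k (by omega))
    obtain ⟨m, hm⟩ : ∃ m : Fin n, (m : ℕ) = a - d := ⟨⟨a - d, by omega⟩, rfl⟩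
    have hkm : (k : ℕ) + 1 = m := by omega
    have hkm' : k ≠ m := fun h => by subst h; omega
    have hyk1 : y k = 1 := by omega
    have hym : y m = 0 := hlarge m hm.ge
    -- The eigenvalue equation is read at `x`, which is `y` with the excitation at the frontier `k`
    -- moved to `m`, inside the empty region. There `v x = 0`, and `y` will be the only
    -- configuration contributing to `(H v) x`.
    set x : Cfg n := y ∘ Equiv.swap k m with hx
    have hxk : x k = 0 := by simp [hx, hym]
    have hxm : x m = 1 := by simp [hx, hyk1]
    have hxo : ∀ i, i ≠ k → i ≠ m → x i = y i := fun i h1 h2 => by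
      simp [hx, Equiv.swap_apply_of_ne_of_ne h1 h2]
    have hvx : v x = 0 := ih (by omega) x ⟨m, hm.ge, by rw [hxm]; decide⟩
    have hsum : ∑ z, H x z * v z = 0 := by
      have := congrFun hv x
      rw [Pi.smul_apply, hvx, smul_zero] at this
      exact this
    rw [Finset.sum_eq_single y] at hsum
    · obtain ⟨c, hc⟩ := hnn.exists_hopping hkm
      have hne : H x y ≠ 0 := by
        rw [hx, hc y hyk1 hym, ← hc (oneExcitation k) (by simp [oneExcitation])
          (by simp [oneExcitation, hkm'.symm]), oneExcitation_comp_swap]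
        exact hhop k m hkm
      exact (mul_eq_zero.mp hsum).resolve_left hne
    · intro z _ hzy
      by_contra hne
      have hHxz := left_ne_zero_of_mul hne
      have hvz := right_ne_zero_of_mul hne
      have hz : ∀ i : Fin n, a - d ≤ i → z i = 0 := fun i hi => by
        by_contra hzi
        exact hvz (ih (by omega) z ⟨i, hi, hzi⟩)
      have hexc : excitations x = excitations z := by
        by_contra h
        exact hHxz (apply_eq_zero_of_excitations_ne hcons h)
      -- A contributing `z` is empty at `m`, where `x` is excited, so by conservation it must exceed
      -- `x` somewhere. The bond linking them contains `m`, and its other site cannot lie in the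
      -- empty region; hence it is `k`, which forces `z = y`.
      have hnlt : ¬ ∀ i, z i ≤ x i := fun hle => by
        have := excitations_lt hle (k := m) (by rw [hz m hm.ge, hxm]; decide)
        omega
      obtain ⟨i, j, hij, hall⟩ := hnn.exists_bond hHxz
      have hmij : m = i ∨ m = j := by
        by_contra! hcon
        have := hall m hcon.1 hcon.2
        rw [hxm, hz m hm.ge] at this
        exact absurd this (by decide)
      rcases hmij with rfl | rfl
      · refine hnlt fun i => ?_
        by_cases h1 : i = m
        · subst h1; rw [hz i hm.ge]; exact Fin.zero_le _
        by_cases h2 : i = j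
        · subst h2; rw [hz i (by omega)]; exact Fin.zero_le _
        exact (hall i h1 h2).ge
      · obtain rfl : i = k := Fin.ext (by omega)
        by_cases hzi : z i = 0
        · refine hnlt fun r => ?_
          by_cases h1 : r = i
          · subst h1; rw [hzi]; exact Fin.zero_le _
          by_cases h2 : r = m
          · subst h2; rw [hz r hm.ge]; exact Fin.zero_le _
          exact (hall r h1 h2).ge
        · apply hzy
          funext r
          by_cases h1 : r = i
          · subst h1; omega
          by_cases h2 : r = m
          · subst h2; rw [hz r hm.ge, hym]
          rw [← hall r h1 h2, hxo r h1 h2]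
    · simp

end Chain

/-! ### Positive semidefinite matrices -/

section PosSemidef

variable {X : Type*} [Fintype X] [DecidableEq X]

open scoped MatrixOrder in
theorem Matrix.PosSemidef.exists_sqrt {P : Op X} (hP : P.PosSemidef) :
    ∃ S : Op X, S.PosSemidef ∧ S * S = P :=
  ⟨CFC.sqrt P, (CFC.sqrt_nonneg P).posSemidef, CFC.sqrt_mul_sqrt_self P hP.nonneg⟩

/-- Cauchy–Schwarz: `ρ` is the Gram matrix of the columns of its square root. -/
theorem Matrix.PosSemidef.norm_apply_sq_le {ρ : Op X} (hρ : ρ.PosSemidef) (x y : X) :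
    ‖ρ x y‖ ^ 2 ≤ (ρ x x).re * (ρ y y).re := by
  obtain ⟨S, hS, rfl⟩ := hρ.exists_sqrt
  have hentry : ∀ x y, (S * S) x y =
      inner ℂ (WithLp.toLp 2 (Sᵀ x) : Ket X) (WithLp.toLp 2 (Sᵀ y)) := fun x y => by
    rw [EuclideanSpace.inner_toLp_toLp, mul_apply, dotProduct]
    refine Finset.sum_congr rfl fun z _ => ?_
    rw [Pi.star_apply, transpose_apply, transpose_apply, hS.1.apply, mul_comm]
  have hdiag : ∀ x, ((S * S) x x).re = ‖(WithLp.toLp 2 (Sᵀ x) : Ket X)‖ ^ 2 := fun x => by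
    rw [hentry, inner_self_eq_norm_sq_to_K]
    norm_cast
  rw [hdiag, hdiag, hentry, ← mul_pow]
  gcongr
  exact norm_inner_le_norm _ _

/-- The conditions are closed. The diagonal entries are nonnegative with sum `1`, and they bound the
off-diagonal ones, so all entries lie in the unit disc. -/
theorem isCompact_densityMatrices : IsCompact (densityMatrices X) := by
  have hclosed : IsClosed (densityMatrices X) := by
    have hset : densityMatrices X = {ρ : Op X | ρᴴ = ρ} ∩
        (⋂ v : X → ℂ, {ρ : Op X | 0 ≤ star v ⬝ᵥ (ρ *ᵥ v)}) ∩ {ρ | ρ.trace = 1} := by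
      ext ρ
      simp [densityMatrices, posSemidef_iff_dotProduct_mulVec, IsHermitian]
    rw [hset]
    refine ((isClosed_eq (by fun_prop) continuous_id).inter (isClosed_iInter fun v => ?_)).inter
      (isClosed_eq (by fun_prop) continuous_const)
    exact isClosed_le continuous_const (by fun_prop)
  have hK : IsCompact (Set.univ.pi fun _ : X => Set.univ.pi fun _ : X =>
      Metric.closedBall (0 : ℂ) 1) :=
    isCompact_univ_pi fun _ => isCompact_univ_pi fun _ => isCompact_closedBall 0 1
  refine IsCompact.of_isClosed_subset hK hclosed ?_
  rintro ρ ⟨hρ, htr⟩ x - y -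
  have hd : ∀ x, 0 ≤ (ρ x x).re := fun x => (Complex.le_def.mp hρ.diag_nonneg).1
  have hle : ∀ x, (ρ x x).re ≤ 1 := fun x => by
    have h1 : ∑ z, (ρ z z).re = 1 := by
      rw [← Complex.re_sum]
      exact congrArg Complex.re htr
    rw [← h1]
    exact Finset.single_le_sum (f := fun z => (ρ z z).re) (fun z _ => hd z) (Finset.mem_univ x)
  rw [mem_closedBall_zero_iff]
  have h2 := hρ.norm_apply_sq_le x y
  have h3 : (ρ x x).re * (ρ y y).re ≤ 1 := mul_le_one₀ (hle x) (hd y) (hle y)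
  nlinarith [norm_nonneg (ρ x y)]

end PosSemidef

/-- A continuous self-map of a compact set along which a nonnegative continuous function decreases,
and is eventually strictly decreasing where it is positive, drives this function to zero. -/
theorem tendsto_iterate_zero_of_strict_lyapunov {α : Type*} [TopologicalSpace α] {K : Set α}
    (hK : IsCompact K) {τ : α → α} (hτ : Continuous τ) (hmaps : Set.MapsTo τ K K) {g : α → ℝ}
    (hg : Continuous g) (hg0 : ∀ a ∈ K, 0 ≤ g a) (hdec : ∀ a ∈ K, g (τ a) ≤ g a)
    (hstrict : ∀ a ∈ K, (∀ n, g (τ^[n] a) = g a) → g a = 0) {a : α} (ha : a ∈ K) :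
    Tendsto (fun n => g (τ^[n] a)) atTop (𝓝 0) := by
  have hmem : ∀ n, τ^[n] a ∈ K := fun n => hmaps.iterate n ha
  have hanti : Antitone fun n => g (τ^[n] a) := antitone_nat_of_succ_le fun n => by
    rw [Function.iterate_succ_apply']
    exact hdec _ (hmem n)
  have hbdd : BddBelow (Set.range fun n => g (τ^[n] a)) :=
    ⟨0, by rintro _ ⟨n, rfl⟩; exact hg0 _ (hmem n)⟩
  have hlim := tendsto_atTop_ciInf hanti hbdd
  set c := ⨅ n, g (τ^[n] a)
  -- A limit `σ` along a free ultrafilter needs no subsequences. Shifting the orbit does not change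
  -- the limit of `g`, so `g` is constant along the orbit of `σ`, and `hstrict` applies there.
  have hF : (hyperfilter ℕ : Filter ℕ) ≤ atTop := Nat.hyperfilter_le_atTop
  obtain ⟨σ, hσK, hσ⟩ := hK.ultrafilter_le_nhds ((hyperfilter ℕ).map fun n => τ^[n] a)
    (by rw [Ultrafilter.coe_map]; exact tendsto_principal.mpr (Eventually.of_forall hmem))
  have hσ' : Tendsto (fun n => τ^[n] a) (hyperfilter ℕ) (𝓝 σ) := hσ
  have hconst : ∀ k, g (τ^[k] σ) = c := fun k => by
    have h1 : Tendsto (fun n => g (τ^[k] (τ^[n] a))) (hyperfilter ℕ) (𝓝 (g (τ^[k] σ))) :=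
      ((hg.comp (hτ.iterate k)).tendsto σ).comp hσ'
    have h2 : Tendsto (fun n => g (τ^[k] (τ^[n] a))) (hyperfilter ℕ) (𝓝 c) := by
      have h3 := (tendsto_add_atTop_iff_nat k).mpr hlim
      refine (h3.mono_left hF).congr fun n => ?_
      rw [add_comm, Function.iterate_add_apply]
    exact tendsto_nhds_unique h1 h2
  have hc : c = 0 := by
    rw [← hconst 0]
    exact hstrict σ hσK fun n => (hconst n).trans (hconst 0).symm
  rwa [hc] at hlim

/-! ### The reduced map -/

section ReducedMap

variable {X Y : Type*} [Fintype X] [Fintype Y] [DecidableEq Y] [Zero Y]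

/-- The Kraus operators `⟨y|U|0⟩` of the reduced map. -/
def kraus (U : Op (X × Y)) (y : Y) : Op X := Matrix.of fun x x' => U (x, y) (x', 0)

theorem ketZero_apply (y : Y) : ketZero Y y = if y = 0 then 1 else 0 := by
  simp [ketZero]

theorem ketBra_apply (v w : Ket X) (x y : X) : ketBra v w x y = v x * star (w y) := rfl

theorem reducedMap_eq_sum_kraus (U : Op (X × Y)) (ρ : Op X) :
    reducedMap U ρ = ∑ y, kraus U y * ρ * (kraus U y)ᴴ := by
  ext x x'
  simp only [reducedMap, traceRight, of_apply, Matrix.sum_apply]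
  refine Finset.sum_congr rfl fun y _ => ?_
  simp only [mul_apply, Fintype.sum_prod_type, kroneckerMap_apply, ketBra_apply, ketZero_apply,
    conjTranspose_apply, kraus, of_apply]
  simp [apply_ite, Finset.sum_ite_eq']

theorem mulVec_ketTensor_ketZero (U : Op (X × Y)) (v : X → ℂ) (x : X) (y : Y) :
    (U *ᵥ fun p => v p.1 * (if p.2 = 0 then 1 else 0)) (x, y) = (kraus U y *ᵥ v) x := by
  simp [mulVec, dotProduct, Fintype.sum_prod_type, kraus]

theorem continuous_reducedMap (U : Op (X × Y)) : Continuous (reducedMap U) := by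
  have : reducedMap U = fun ρ => ∑ y, kraus U y * ρ * (kraus U y)ᴴ :=
    funext (reducedMap_eq_sum_kraus U)
  rw [this]
  fun_prop

variable [DecidableEq X]

/-- This is the `|0⟩`-`|0⟩` block of `Uᴴ * U = 1`, and is what makes the reduced map trace
preserving. -/
theorem sum_kraus_conjTranspose_mul_self {U : Op (X × Y)} (hU : Uᴴ * U = 1) :
    ∑ y, (kraus U y)ᴴ * kraus U y = 1 := by
  ext x x'
  have h := congrFun (congrFun hU (x, 0)) (x', 0)
  simp only [mul_apply, conjTranspose_apply, Fintype.sum_prod_type_right, one_apply,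
    Prod.mk.injEq, and_true] at h
  simpa only [Matrix.sum_apply, mul_apply, conjTranspose_apply, kraus, of_apply, one_apply] using h

theorem mapsTo_reducedMap {U : Op (X × Y)} (hU : Uᴴ * U = 1) :
    Set.MapsTo (reducedMap U) (densityMatrices X) (densityMatrices X) := by
  rintro ρ ⟨hρ, htr⟩
  rw [reducedMap_eq_sum_kraus]
  refine ⟨posSemidef_sum _ fun y _ => hρ.mul_mul_conjTranspose_same _, ?_⟩
  rw [trace_sum, ← htr]
  conv_rhs => rw [← Matrix.one_mul ρ, ← sum_kraus_conjTranspose_mul_self hU, Finset.sum_mul,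
    trace_sum]
  refine Finset.sum_congr rfl fun y _ => ?_
  rw [trace_mul_comm, ← Matrix.mul_assoc]

variable [Zero X]

/-- If `U` conserves an additive number of excitations, which vanishes for `|0⟩` only, and has no
eigenvector `|v⟩ ⊗ |0⟩` other than the multiples of `|0⟩ ⊗ |0⟩`, then a vector whose evolution leaves
the controlled part in `|0⟩` for ever is a multiple of `|0⟩`. -/
theorem eq_zero_of_forall_kraus_eq_zero {U : Op (X × Y)} {n : X → ℕ} {m : Y → ℕ}
    (hn : ∀ x, n x = 0 ↔ x = 0) (hm : ∀ y, m y = 0 ↔ y = 0)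
    (hcons : ∀ x y x' y', n x + m y ≠ n x' + m y' → U (x, y) (x', y') = 0)
    (heig : ∀ (v : X → ℂ) (μ : ℂ),
      (U *ᵥ fun p => v p.1 * (if p.2 = 0 then 1 else 0)) =
        μ • (fun p : X × Y => v p.1 * (if p.2 = 0 then 1 else 0)) → ∀ x, x ≠ 0 → v x = 0)
    {v : X → ℂ} (hv : ∀ (k : ℕ) (y : Y), y ≠ 0 → kraus U y *ᵥ ((kraus U 0 ^ k) *ᵥ v) = 0)
    {x : X} (hx : x ≠ 0) : v x = 0 := by
  have hn0 : n 0 = 0 := (hn 0).mpr rfl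
  have hm0 : m 0 = 0 := (hm 0).mpr rfl
  -- Action of the Kraus operators near `|0⟩`.
  have hrow : ∀ x', x' ≠ 0 → kraus U 0 0 x' = 0 := fun x' hx' => by
    refine hcons _ _ _ _ ?_
    have := mt (hn x').mp hx'
    omega
  have hcol : ∀ x y, (x ≠ 0 ∨ y ≠ 0) → kraus U y x 0 = 0 := fun x y hxy => by
    refine hcons _ _ _ _ ?_
    have h1 := mt (hn x).mp
    have h2 := mt (hm y).mp
    rcases hxy with h | h
    · have := h1 h; omega
    · have := h2 h; omega
  -- The non-leaking vectors orthogonal to `|0⟩`. `K` is invariant under `kraus U 0`, and an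
  -- eigenvector of it in `K` would give an eigenvector of `U` excluded by `heig`; so `K` is
  -- trivial.
  let K : Submodule ℂ (X → ℂ) :=
    { carrier := {w | w 0 = 0 ∧
        ∀ (k : ℕ) (y : Y), y ≠ 0 → kraus U y *ᵥ ((kraus U 0 ^ k) *ᵥ w) = 0}
      zero_mem' := by simp
      add_mem' := by
        rintro a b ⟨ha0, ha⟩ ⟨hb0, hb⟩
        refine ⟨by simp [ha0, hb0], fun k y hy => ?_⟩
        rw [mulVec_add, mulVec_add, ha k y hy, hb k y hy, add_zero]
      smul_mem' := by
        rintro c a ⟨ha0, ha⟩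
        refine ⟨by simp [ha0], fun k y hy => ?_⟩
        rw [mulVec_smul, mulVec_smul, ha k y hy, smul_zero] }
  have hKinv : ∀ w ∈ K, (kraus U 0).mulVecLin w ∈ K := by
    rintro w ⟨hw0, hw⟩
    refine ⟨?_, fun k y hy => ?_⟩
    · change ∑ x', kraus U 0 0 x' * w x' = 0
      refine Finset.sum_eq_zero fun x' _ => ?_
      by_cases hx' : x' = 0
      · rw [hx', hw0, mul_zero]
      · rw [hrow x' hx', zero_mul]
    · rw [mulVecLin_apply, mulVec_mulVec _ (kraus U 0 ^ k), ← pow_succ]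
      exact hw (k + 1) y hy
  have hKbot : K = ⊥ := by
    by_contra hne
    have : Nontrivial K := Submodule.nontrivial_iff_ne_bot.mpr hne
    obtain ⟨μ, hμ⟩ := Module.End.exists_eigenvalue ((kraus U 0).mulVecLin.restrict hKinv)
    obtain ⟨⟨w, hwK⟩, hw⟩ := hμ.exists_hasEigenvector
    have hwμ : kraus U 0 *ᵥ w = μ • w := by
      have := congrArg Subtype.val hw.apply_eq_smul
      exact this
    have hw0 : w = 0 := by
      funext x
      by_cases hx : x = 0
      · rw [hx]; exact hwK.1
      refine heig w μ ?_ x hx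
      funext ⟨x, y⟩
      rw [mulVec_ketTensor_ketZero]
      by_cases hy : y = 0
      · rw [hy, hwμ]; simp
      · have := hwK.2 0 y hy
        rw [pow_zero, one_mulVec] at this
        rw [this]; simp [hy]
    exact hw.2 (Subtype.ext hw0)
  have hpow : ∀ k, (kraus U 0 ^ k) *ᵥ (Pi.single 0 1 : X → ℂ) =
      (kraus U 0 0 0) ^ k • (Pi.single 0 1 : X → ℂ) := by
    intro k
    induction k with
    | zero => rw [pow_zero, one_mulVec, pow_zero, one_smul]
    | succ k ih =>
      rw [pow_succ', ← mulVec_mulVec, ih, mulVec_smul, pow_succ, mul_smul]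
      congr 1
      funext x
      rw [mulVec_single_one, col_apply]
      by_cases hx : x = 0
      · simp [hx]
      · simp [hx, hcol x 0 (Or.inl hx)]
  -- The vector `|0⟩` is an eigenvector of `kraus U 0` and does not leak, so removing the `|0⟩`
  -- component of `v` keeps the non-leaking condition.
  have hmem : v - v 0 • (Pi.single 0 1 : X → ℂ) ∈ K := by
    refine ⟨by simp, fun k y hy => ?_⟩
    rw [mulVec_sub, mulVec_sub, hv k y hy, mulVec_smul, mulVec_smul, hpow, mulVec_smul]
    have : kraus U y *ᵥ (Pi.single 0 1 : X → ℂ) = 0 := by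
      funext x
      rw [mulVec_single_one, col_apply]
      exact hcol x y (Or.inr hy)
    simp [this]
  rw [hKbot, Submodule.mem_bot] at hmem
  have := congrFun hmem x
  simpa [hx] using this

theorem ketBra_ketZero_mem_densityMatrices :
    ketBra (ketZero X) (ketZero X) ∈ densityMatrices X := by
  refine ⟨posSemidef_vecMulVec_self_star _, ?_⟩
  simp [trace, ketBra_apply, ketZero_apply]

/-- Density matrices converge to `|0⟩⟨0|` if their other diagonal entries tend to zero. -/
theorem tendsto_ketBra_ketZero {ρ : ℕ → Op X} (hρ : ∀ k, ρ k ∈ densityMatrices X)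
    (hlim : ∀ x, x ≠ 0 → Tendsto (fun k => (ρ k x x).re) atTop (𝓝 0)) :
    Tendsto ρ atTop (𝓝 (ketBra (ketZero X) (ketZero X))) := by
  have hdiag : ∀ k x, 0 ≤ (ρ k x x).re := fun k x =>
    (Complex.le_def.mp (hρ k).1.diag_nonneg).1
  have him : ∀ k x, (ρ k x x).im = 0 := fun k x =>
    (Complex.le_def.mp (hρ k).1.diag_nonneg).2.symm
  have hsum : ∀ k, ∑ x, (ρ k x x).re = 1 := fun k => by
    rw [← Complex.re_sum]
    exact congrArg Complex.re (hρ k).2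
  have hle : ∀ k x, (ρ k x x).re ≤ 1 := fun k x => by
    rw [← hsum k]
    exact Finset.single_le_sum (f := fun x => (ρ k x x).re) (fun x _ => hdiag k x)
      (Finset.mem_univ x)
  -- An entry in a row or column other than `0` is at most the square root of the corresponding
  -- diagonal entry. The entry at `0`, `0` is then fixed by the trace.
  have hoff : ∀ x, x ≠ 0 → ∀ y, Tendsto (fun k => ρ k x y) atTop (𝓝 0) ∧
      Tendsto (fun k => ρ k y x) atTop (𝓝 0) := fun x hx y => by
    have hsqrt : Tendsto (fun k => √((ρ k x x).re)) atTop (𝓝 0) := by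
      simpa using (hlim x hx).sqrt
    constructor
    · refine squeeze_zero_norm (fun k => Real.le_sqrt_of_sq_le ?_) hsqrt
      exact ((hρ k).1.norm_apply_sq_le x y).trans (mul_le_of_le_one_right (hdiag k x) (hle k y))
    · refine squeeze_zero_norm (fun k => Real.le_sqrt_of_sq_le ?_) hsqrt
      exact ((hρ k).1.norm_apply_sq_le y x).trans (mul_le_of_le_one_left (hdiag k x) (hle k y))
  have hzero : Tendsto (fun k => ρ k 0 0) atTop (𝓝 1) := by
    have h1 : ∀ k, ρ k 0 0 = 1 - ∑ x ∈ Finset.univ.erase 0, ρ k x x := fun k => by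
      rw [← (hρ k).2, trace, ← Finset.add_sum_erase _ _ (Finset.mem_univ (0 : X))]
      simp
    simp only [h1]
    have h2 : Tendsto (fun k => ∑ x ∈ Finset.univ.erase (0 : X), ρ k x x) atTop (𝓝 0) := by
      rw [← Finset.sum_const_zero (s := Finset.univ.erase (0 : X))]
      exact tendsto_finsetSum _ fun x hx => (hoff x (Finset.ne_of_mem_erase hx) x).1
    simpa using h2.const_sub 1
  refine tendsto_pi_nhds.mpr fun x => tendsto_pi_nhds.mpr fun y => ?_
  rw [ketBra_apply, ketZero_apply, ketZero_apply]
  by_cases hx : x = 0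
  · by_cases hy : y = 0
    · subst hx hy; simpa using hzero
    · simpa [hy] using (hoff y hy x).2
  · simpa [hx] using (hoff x hx y).1

/-- The reduced map is mixing toward `|0⟩⟨0|` if `U` conserves the number of excitations and has no
eigenvector `|v⟩ ⊗ |0⟩` other than the multiples of `|0⟩ ⊗ |0⟩`. -/
theorem isMixingToward_reducedMap {U : Op (X × Y)} (hU : Uᴴ * U = 1) {n : X → ℕ} {m : Y → ℕ}
    (hn : ∀ x, n x = 0 ↔ x = 0) (hm : ∀ y, m y = 0 ↔ y = 0)
    (hcons : ∀ x y x' y', n x + m y ≠ n x' + m y' → U (x, y) (x', y') = 0)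
    (heig : ∀ (v : X → ℂ) (μ : ℂ),
      (U *ᵥ fun p => v p.1 * (if p.2 = 0 then 1 else 0)) =
        μ • (fun p : X × Y => v p.1 * (if p.2 = 0 then 1 else 0)) → ∀ x, x ≠ 0 → v x = 0) :
    IsMixingToward (reducedMap U) (ketBra (ketZero X) (ketZero X)) := by
  have hmaps := mapsTo_reducedMap hU
  let N : Op X := diagonal fun x => (n x : ℂ)
  -- The Lyapunov function is the expected number of excitations. By `hNK`, the Kraus operator of
  -- outcome `y` removes exactly `m y` of them.
  let g : Op X → ℝ := fun ρ => (N * ρ).trace.re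
  have hgsum : ∀ ρ, g ρ = ∑ x, (n x : ℝ) * (ρ x x).re := fun ρ => by
    simp only [g, N, trace, diag_apply, diagonal_mul, Complex.re_sum]
    refine Finset.sum_congr rfl fun x _ => ?_
    rw [← Complex.ofReal_natCast, Complex.re_ofReal_mul]
  have hdiag : ∀ ρ ∈ densityMatrices X, ∀ x, 0 ≤ (ρ x x).re := fun ρ hρ x =>
    (Complex.le_def.mp hρ.1.diag_nonneg).1
  have hg0 : ∀ ρ ∈ densityMatrices X, 0 ≤ g ρ := fun ρ hρ => by
    rw [hgsum]
    exact Finset.sum_nonneg fun x _ => mul_nonneg (Nat.cast_nonneg _) (hdiag ρ hρ x)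
  have hgc : Continuous g := Complex.continuous_re.comp (by fun_prop)
  have hNK : ∀ y, N * kraus U y = kraus U y * N - (m y : ℂ) • kraus U y := fun y => by
    ext x x'
    simp only [N, diagonal_mul, mul_diagonal, Matrix.sub_apply, Matrix.smul_apply, smul_eq_mul]
    by_cases h : n x + m y = n x' + m 0
    · rw [(hm 0).mpr rfl, add_zero] at h
      rw [← h]
      push_cast
      ring
    · have : kraus U y x x' = 0 := hcons _ _ _ _ h
      rw [this]; ring
  have hdrop : ∀ ρ, g (reducedMap U ρ) =
      g ρ - ∑ y, (m y : ℝ) * (kraus U y * ρ * (kraus U y)ᴴ).trace.re := fun ρ => by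
    have h1 : (N * reducedMap U ρ).trace =
        (N * ρ).trace - ∑ y, (m y : ℂ) * (kraus U y * ρ * (kraus U y)ᴴ).trace := by
      rw [reducedMap_eq_sum_kraus, Finset.mul_sum, trace_sum]
      have h2 : (N * ρ).trace = ∑ y, (kraus U y * N * ρ * (kraus U y)ᴴ).trace := by
        conv_lhs => rw [← Matrix.one_mul (N * ρ), ← sum_kraus_conjTranspose_mul_self hU,
          Finset.sum_mul, trace_sum]
        refine Finset.sum_congr rfl fun y _ => ?_
        rw [trace_mul_comm (kraus U y * N * ρ)]
        simp only [Matrix.mul_assoc]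
      rw [h2, ← Finset.sum_sub_distrib]
      refine Finset.sum_congr rfl fun y _ => ?_
      rw [← Matrix.mul_assoc, ← Matrix.mul_assoc, hNK, Matrix.sub_mul, Matrix.sub_mul, trace_sub,
        Matrix.smul_mul, Matrix.smul_mul, trace_smul, smul_eq_mul]
    simp only [g]
    rw [h1, Complex.sub_re, Complex.re_sum]
    congr 1
    refine Finset.sum_congr rfl fun y _ => ?_
    rw [← Complex.ofReal_natCast, Complex.re_ofReal_mul]
  have hloss : ∀ ρ ∈ densityMatrices X, ∀ y,
      0 ≤ (m y : ℝ) * (kraus U y * ρ * (kraus U y)ᴴ).trace.re := fun ρ hρ y =>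
    mul_nonneg (Nat.cast_nonneg _)
      (Complex.le_def.mp (hρ.1.mul_mul_conjTranspose_same _).trace_nonneg).1
  have hstrict : ∀ ρ ∈ densityMatrices X, (∀ k, g ((reducedMap U)^[k] ρ) = g ρ) → g ρ = 0 := by
    intro ρ hρ hconst
    obtain ⟨S, hS, hSρ⟩ := hρ.1.exists_sqrt
    -- Without loss, every outcome `y ≠ 0` has probability zero. Only the Kraus operator of `0` then
    -- acts, and the orbit stays of the form `A * Aᴴ` with `A = kraus U 0 ^ k * S`; thus the columns
    -- of `S` never leak.
    have hstep : ∀ k, (reducedMap U)^[k] ρ = (kraus U 0 ^ k * S) * (kraus U 0 ^ k * S)ᴴ →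
        ∀ y, y ≠ 0 → kraus U y * (kraus U 0 ^ k * S) = 0 := by
      intro k hk y hy
      have hmem : (reducedMap U)^[k] ρ ∈ densityMatrices X := hmaps.iterate k hρ
      have h1 := hdrop ((reducedMap U)^[k] ρ)
      rw [← Function.iterate_succ_apply' (reducedMap U), hconst, hconst] at h1
      have h2 : ∑ y, (m y : ℝ) * (kraus U y * (reducedMap U)^[k] ρ * (kraus U y)ᴴ).trace.re = 0 := by
        linarith
      have h3 := (Finset.sum_eq_zero_iff_of_nonneg fun y _ => hloss _ hmem y).mp h2 y
        (Finset.mem_univ y)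
      have h4 : (kraus U y * (reducedMap U)^[k] ρ * (kraus U y)ᴴ).trace.re = 0 :=
        (mul_eq_zero.mp h3).resolve_left (Nat.cast_ne_zero.mpr (mt (hm y).mp hy))
      have hpsd := hmem.1.mul_mul_conjTranspose_same (kraus U y)
      have h5 : (kraus U y * (reducedMap U)^[k] ρ * (kraus U y)ᴴ).trace = 0 :=
        Complex.ext h4 (Complex.le_def.mp hpsd.trace_nonneg).2.symm
      have h6 := hpsd.trace_eq_zero_iff.mp h5
      rw [hk, Matrix.mul_assoc, Matrix.mul_assoc, ← conjTranspose_mul, ← Matrix.mul_assoc] at h6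
      exact self_mul_conjTranspose_eq_zero.mp h6
    have horbit : ∀ k, (reducedMap U)^[k] ρ = (kraus U 0 ^ k * S) * (kraus U 0 ^ k * S)ᴴ := by
      intro k
      induction k with
      | zero => rw [Function.iterate_zero, id, pow_zero, Matrix.one_mul, hS.1.eq, hSρ]
      | succ k ih =>
        have h0 := hstep k ih
        rw [Function.iterate_succ_apply', ih, reducedMap_eq_sum_kraus, Finset.sum_eq_single 0]
        · rw [pow_succ', Matrix.mul_assoc (kraus U 0) (kraus U 0 ^ k) S,
            conjTranspose_mul (kraus U 0) (kraus U 0 ^ k * S)]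
          simp only [Matrix.mul_assoc]
        · intro y _ hy
          rw [← Matrix.mul_assoc, h0 y hy, Matrix.zero_mul, Matrix.zero_mul]
        · simp
    have hSx : ∀ x, x ≠ 0 → ∀ j, S x j = 0 := fun x hx j => by
      refine eq_zero_of_forall_kraus_eq_zero hn hm hcons heig (v := S.col j) (fun k y hy => ?_) hx
      have h := hstep k (horbit k) y hy
      rw [mulVec_mulVec, ← mulVec_single_one, mulVec_mulVec, Matrix.mul_assoc, h, zero_mulVec]
    rw [hgsum]
    refine Finset.sum_eq_zero fun x _ => ?_
    by_cases hx : x = 0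
    · rw [(hn x).mpr hx]; simp
    · rw [← hSρ, mul_apply]
      simp [hSx x hx]
  refine ⟨hmaps, ketBra_ketZero_mem_densityMatrices, fun ρ hρ => ?_⟩
  have hlim := tendsto_iterate_zero_of_strict_lyapunov isCompact_densityMatrices
    (continuous_reducedMap U) hmaps hgc hg0
    (fun ρ hρ => by
      rw [hdrop]
      linarith [Finset.sum_nonneg fun y (_ : y ∈ Finset.univ) => hloss ρ hρ y]) hstrict hρ
  have hmem : ∀ k, (reducedMap U)^[k] ρ ∈ densityMatrices X := fun k => hmaps.iterate k hρ
  refine tendsto_ketBra_ketZero hmem fun x hx => ?_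
  refine squeeze_zero (fun k => hdiag _ (hmem k) x) (fun k => ?_) hlim
  rw [hgsum]
  have h1 : (1 : ℝ) ≤ n x := by
    exact_mod_cast Nat.one_le_iff_ne_zero.mpr (mt (hn x).mp hx)
  calc (((reducedMap U)^[k] ρ) x x).re ≤ (n x : ℝ) * (((reducedMap U)^[k] ρ) x x).re :=
        le_mul_of_one_le_left (hdiag _ (hmem k) x) h1
    _ ≤ _ := Finset.single_le_sum (f := fun x => (n x : ℝ) * (((reducedMap U)^[k] ρ) x x).re)
        (fun x _ => mul_nonneg (Nat.cast_nonneg _) (hdiag _ (hmem k) x)) (Finset.mem_univ x)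

end ReducedMap

/-! ### The protocol -/

section Protocol

variable {X Y : Type*} {L : ℕ}

theorem swapLabel_swapLabel (l : Fin L) (p : (X × Y) × (Fin L → Y)) :
    swapLabel l (swapLabel l p) = p := by
  simp [swapLabel]

variable [Fintype X] [DecidableEq X] [Fintype Y] [DecidableEq Y]

theorem swapOp_mulVec (l : Fin L) (f : (X × Y) × (Fin L → Y) → ℂ) (p : (X × Y) × (Fin L → Y)) :
    (swapOp l *ᵥ f) p = f (swapLabel l p) := by
  have h : ∀ q, p = swapLabel l q ↔ q = swapLabel l p := fun q =>
    ⟨fun h => by rw [h, swapLabel_swapLabel], fun h => by rw [h, swapLabel_swapLabel]⟩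
  simp [mulVec, dotProduct, swapOp, h]

theorem swapOp_conjTranspose_mul_self (l : Fin L) :
    (swapOp l : Op ((X × Y) × (Fin L → Y)))ᴴ * swapOp l = 1 := by
  have hinj : Function.Injective (swapLabel l : (X × Y) × (Fin L → Y) → _) :=
    Function.LeftInverse.injective (swapLabel_swapLabel l)
  ext p q
  simp [mul_apply, swapOp, one_apply, hinj.eq_iff, eq_comm]

theorem kronecker_one_mulVec {P Z : Type*} [Fintype P] [Fintype Z] [DecidableEq Z] (U : Op P)
    (f : P × Z → ℂ) (p : P) (z : Z) :
    ((U ⊗ₖ (1 : Op Z)) *ᵥ f) (p, z) = ∑ q, U p q * f (q, z) := by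
  simp [mulVec, dotProduct, Fintype.sum_prod_type, one_apply]

theorem protocolSteps_conjTranspose_mul_self {U : Op (X × Y)} (hU : Uᴴ * U = 1) (L k : ℕ) :
    (protocolSteps L U k)ᴴ * protocolSteps L U k = 1 := by
  induction k with
  | zero => simp [protocolSteps]
  | succ k ih =>
    rw [protocolSteps]
    split_ifs with h
    · have h1 : (U ⊗ₖ (1 : Op (Fin L → Y)))ᴴ * (U ⊗ₖ (1 : Op (Fin L → Y))) = 1 := by
        rw [conjTranspose_kronecker, ← mul_kronecker_mul, hU, conjTranspose_one, Matrix.one_mul,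
          one_kronecker_one]
      set S : Op ((X × Y) × (Fin L → Y)) := swapOp ⟨k, h⟩
      set K := U ⊗ₖ (1 : Op (Fin L → Y))
      set W := protocolSteps L U k
      have h2 : Sᴴ * S = 1 := swapOp_conjTranspose_mul_self _
      calc (S * K * W)ᴴ * (S * K * W) = Wᴴ * (Kᴴ * (Sᴴ * S) * K) * W := by
            simp only [conjTranspose_mul, Matrix.mul_assoc]
        _ = 1 := by rw [h2, Matrix.mul_one, h1, Matrix.mul_one, ih]
    · exact ih

theorem protocol_conjTranspose_mul_self {U : Op (X × Y)} (hU : Uᴴ * U = 1) (L : ℕ) :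
    (protocol L U)ᴴ * protocol L U = 1 :=
  protocolSteps_conjTranspose_mul_self hU L L

theorem traceRight_mem_densityMatrices {U : Op (X × Y)} (hU : Uᴴ * U = 1) {ψ : Ket (X × Y)}
    (hψ : ‖ψ‖ = 1) : traceRight (U * ketBra ψ ψ * Uᴴ) ∈ densityMatrices X := by
  have hpsd : (U * ketBra ψ ψ * Uᴴ).PosSemidef :=
    (posSemidef_vecMulVec_self_star ψ.ofLp).mul_mul_conjTranspose_same U
  refine ⟨?_, ?_⟩
  · have : traceRight (U * ketBra ψ ψ * Uᴴ) =
        ∑ y, (U * ketBra ψ ψ * Uᴴ).submatrix (fun x => (x, y)) fun x => (x, y) := by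
      ext x x'
      simp [traceRight, Matrix.sum_apply]
    rw [this]
    exact posSemidef_sum _ fun y _ => hpsd.submatrix _
  · have h1 : (traceRight (U * ketBra ψ ψ * Uᴴ)).trace = (U * ketBra ψ ψ * Uᴴ).trace := by
      simp only [trace, traceRight, diag_apply, of_apply, Fintype.sum_prod_type]
    rw [h1, trace_mul_comm, ← Matrix.mul_assoc, hU, Matrix.one_mul, ketBra, trace_vecMulVec,
      ← EuclideanSpace.inner_eq_star_dotProduct, inner_self_eq_norm_sq_to_K, hψ]
    simp

variable [Zero Y]

/-- The state of system and memory after `k` rounds. -/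
noncomputable def protocolState (L : ℕ) (U : Op (X × Y)) (ψ : Ket (X × Y)) (k : ℕ) :
    (X × Y) × (Fin L → Y) → ℂ :=
  protocolSteps L U k *ᵥ (ketTensor ψ (ketZero (Fin L → Y))).ofLp

theorem protocolState_zero (U : Op (X × Y)) (ψ : Ket (X × Y)) (p : X × Y) (m : Fin L → Y) :
    protocolState L U ψ 0 (p, m) = ψ p * if m = 0 then 1 else 0 := by
  rw [protocolState, protocolSteps, one_mulVec]
  simp [ketTensor, ketZero_apply]

theorem protocolState_succ (U : Op (X × Y)) (ψ : Ket (X × Y)) {k : ℕ} (hk : k < L)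
    (x : X) (y : Y) (m : Fin L → Y) :
    protocolState L U ψ (k + 1) ((x, y), m) =
      ∑ q, U (x, m ⟨k, hk⟩) q * protocolState L U ψ k (q, Function.update m ⟨k, hk⟩ y) := by
  rw [protocolState, protocolSteps, dif_pos hk, ← mulVec_mulVec, ← mulVec_mulVec, swapOp_mulVec,
    swapLabel, kronecker_one_mulVec]
  rfl

/-- The registers that have not been used yet are in the state `|0⟩`. -/
theorem protocolState_eq_zero_of_memory (U : Op (X × Y)) (ψ : Ket (X × Y)) {k : ℕ} (hk : k ≤ L)
    (p : X × Y) {m : Fin L → Y} {j : Fin L} (hj : k ≤ j) (hm : m j ≠ 0) :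
    protocolState L U ψ k (p, m) = 0 := by
  induction k generalizing p m with
  | zero =>
    rw [protocolState_zero, if_neg fun h => hm (by rw [h]; rfl), mul_zero]
  | succ k ih =>
    obtain ⟨x, y⟩ := p
    rw [protocolState_succ U ψ (by omega)]
    refine Finset.sum_eq_zero fun q _ => ?_
    rw [ih (by omega) q (by omega), mul_zero]
    rwa [Function.update_of_ne]
    exact fun h => by simp [h] at hj

/-- After each round the controlled part is in the state `|0⟩`. -/
theorem protocolState_succ_eq_zero (U : Op (X × Y)) (ψ : Ket (X × Y)) {k : ℕ} (hk : k < L)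
    (x : X) {y : Y} (hy : y ≠ 0) (m : Fin L → Y) :
    protocolState L U ψ (k + 1) ((x, y), m) = 0 := by
  rw [protocolState_succ U ψ hk]
  refine Finset.sum_eq_zero fun q _ => ?_
  rw [protocolState_eq_zero_of_memory U ψ hk.le q (j := ⟨k, hk⟩) le_rfl (by simpa using hy),
    mul_zero]

/-- The state of the uncontrolled part after `k` rounds. -/
noncomputable def reducedState (L : ℕ) (U : Op (X × Y)) (ψ : Ket (X × Y)) (k : ℕ) : Op X :=
  Matrix.of fun x x' =>
    ∑ m, protocolState L U ψ k ((x, 0), m) * star (protocolState L U ψ k ((x', 0), m))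

/-- A memory configuration amounts to the content of register `j` together with the configuration in
which that register is reset. Summing over a freshly filled register thus becomes the sum over Kraus
indices. -/
theorem sum_update_eq {ι : Type*} [Fintype ι] [DecidableEq ι] (j : ι) (F : Y → (ι → Y) → ℂ)
    (hF : ∀ y m, m j ≠ 0 → F y m = 0) :
    ∑ m : ι → Y, F (m j) (Function.update m j 0) = ∑ y, ∑ m, F y m := by
  classical
  have h1 : ∑ y, ∑ m, F y m = ∑ y, ∑ m ∈ Finset.univ.filter fun m : ι → Y => m j = 0, F y m := by
    refine Finset.sum_congr rfl fun y _ => ?_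
    rw [Finset.sum_filter]
    refine Finset.sum_congr rfl fun m _ => ?_
    split_ifs with h
    · rfl
    · exact hF y m h
  rw [h1, ← Finset.sum_product']
  refine Finset.sum_bij' (fun m _ => (m j, Function.update m j 0))
    (fun q _ => Function.update q.2 j q.1) ?_ ?_ ?_ ?_ ?_
  · intro m _; simp
  · intro q _; simp
  · intro m _; simp
  · rintro ⟨y, m⟩ h
    simp only [Finset.mem_product, Finset.mem_univ, Finset.mem_filter, true_and] at h
    simp only [Function.update_self, Function.update_idem, Prod.mk.injEq, true_and]
    rw [← h, Function.update_eq_self]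
  · intro m _; rfl

/-- The first round stands apart: the controlled part is not yet in `|0⟩` but shares the state `ψ`,
so the reduced map takes over only afterwards. -/
theorem reducedState_one (U : Op (X × Y)) (ψ : Ket (X × Y)) (hL : 0 < L) :
    reducedState L U ψ 1 = traceRight (U * ketBra ψ ψ * Uᴴ) := by
  ext x x'
  have h1 : ∀ x (m : Fin L → Y), protocolState L U ψ 1 ((x, 0), m) =
      (U *ᵥ ψ.ofLp) (x, m ⟨0, hL⟩) * if Function.update m ⟨0, hL⟩ 0 = 0 then 1 else 0 := by
    intro x m
    rw [protocolState_succ U ψ hL, mulVec, dotProduct, Finset.sum_mul]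
    refine Finset.sum_congr rfl fun q _ => ?_
    rw [protocolState_zero, mul_assoc]
  have h2 : U * ketBra ψ ψ * Uᴴ = vecMulVec (U *ᵥ ψ.ofLp) (star (U *ᵥ ψ.ofLp)) := by
    rw [ketBra, mul_vecMulVec, vecMulVec_mul, star_mulVec]
  rw [h2]
  simp only [reducedState, of_apply, traceRight, h1, vecMulVec_apply, Pi.star_apply]
  rw [sum_update_eq (ι := Fin L) ⟨0, hL⟩ fun y m => (U *ᵥ ψ.ofLp) (x, y) * (if m = 0 then 1 else 0) *
    star ((U *ᵥ ψ.ofLp) (x', y) * (if m = 0 then 1 else 0))]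
  · simp [apply_ite]
  · intro y m hm
    rw [if_neg fun h => hm (by rw [h]; rfl)]
    simp

/-- The controlled part enters the round in `|0⟩`, and the register used, of index `k + 1` counted
from zero, is still empty. The swap stores the outcome there, so the new amplitudes are given by the
Kraus operators. -/
theorem reducedState_succ (U : Op (X × Y)) (ψ : Ket (X × Y)) {k : ℕ} (hk : k + 1 < L) :
    reducedState L U ψ (k + 2) = reducedMap U (reducedState L U ψ (k + 1)) := by
  have h1 : ∀ x (m : Fin L → Y), protocolState L U ψ (k + 2) ((x, 0), m) =
      ∑ z, kraus U (m ⟨k + 1, hk⟩) x z *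
        protocolState L U ψ (k + 1) ((z, 0), Function.update m ⟨k + 1, hk⟩ 0) := by
    intro x m
    rw [protocolState_succ U ψ hk, Fintype.sum_prod_type]
    refine Finset.sum_congr rfl fun z _ => ?_
    rw [Finset.sum_eq_single 0]
    · rfl
    · intro y _ hy
      rw [protocolState_succ_eq_zero U ψ (by omega) z hy, mul_zero]
    · simp
  ext x x'
  rw [reducedMap_eq_sum_kraus]
  simp only [reducedState, of_apply, h1, Matrix.sum_apply]
  rw [sum_update_eq ⟨k + 1, hk⟩ fun y m =>
    (∑ z, kraus U y x z * protocolState L U ψ (k + 1) ((z, 0), m)) *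
      star (∑ z, kraus U y x' z * protocolState L U ψ (k + 1) ((z, 0), m))]
  · refine Finset.sum_congr rfl fun y _ => ?_
    simp only [mul_apply, of_apply, conjTranspose_apply, star_sum, star_mul', Finset.sum_mul,
      Finset.mul_sum]
    rw [Finset.sum_comm]
    conv_lhs => enter [2, z]; rw [Finset.sum_comm]
    refine Finset.sum_congr rfl fun z _ => Finset.sum_congr rfl fun z' _ =>
      Finset.sum_congr rfl fun m _ => ?_
    ring
  · intro y m hm
    simp [protocolState_eq_zero_of_memory U ψ hk.le _ (j := ⟨k + 1, hk⟩) le_rfl hm]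

theorem reducedState_eq_iterate (U : Op (X × Y)) (ψ : Ket (X × Y)) {k : ℕ} (hk : k < L) :
    reducedState L U ψ (k + 1) = (reducedMap U)^[k] (traceRight (U * ketBra ψ ψ * Uᴴ)) := by
  induction k with
  | zero => exact reducedState_one U ψ hk
  | succ k ih => rw [reducedState_succ U ψ hk, ih (by omega), Function.iterate_succ_apply']

variable [Zero X]

theorem transferred_apply (U : Op (X × Y)) (ψ : Ket (X × Y)) (m : Fin L → Y) :
    transferred L U ψ m = protocolState L U ψ L (0, m) := rfl

theorem weight_eq_reducedState (U : Op (X × Y)) (ψ : Ket (X × Y)) :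
    weight L U ψ = (reducedState L U ψ L 0 0).re := by
  rw [weight, EuclideanSpace.norm_sq_eq]
  simp only [reducedState, of_apply, Complex.re_sum]
  refine Finset.sum_congr rfl fun m _ => ?_
  rw [transferred_apply, RCLike.star_def, Complex.mul_conj, Complex.ofReal_re,
    Complex.normSq_eq_norm_sq]
  rfl

/-- If the reduced map is mixing toward `|0⟩⟨0|`, then the state of the system is transferred
completely to a large memory. -/
theorem tendsto_weight {U : Op (X × Y)} (hU : Uᴴ * U = 1)
    (hmix : IsMixingToward (reducedMap U) (ketBra (ketZero X) (ketZero X)))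
    {ψ : Ket (X × Y)} (hψ : ‖ψ‖ = 1) :
    Tendsto (fun L => weight L U ψ) atTop (𝓝 1) := by
  -- With `k + 1` registers the reduced map is iterated `k` times, starting from the state after the
  -- first round.
  rw [← tendsto_add_atTop_iff_nat 1]
  have h1 := hmix.2.2 _ (traceRight_mem_densityMatrices hU hψ)
  have h2 := (tendsto_pi_nhds.mp (tendsto_pi_nhds.mp h1 0) 0)
  have h3 := (Complex.continuous_re.tendsto _).comp h2
  rw [ketBra_apply, ketZero_apply, if_pos rfl] at h3
  simp only [star_one, mul_one, Complex.one_re] at h3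
  refine h3.congr fun k => ?_
  rw [weight_eq_reducedState, reducedState_eq_iterate U ψ (Nat.lt_succ_self k)]
  rfl

end Protocol

/-! ### Polar decomposition -/

section Polar

variable {Z : Type*} [Fintype Z] [DecidableEq Z]

theorem toEuclideanLin_eq_toLp (A : Op Z) (v : Ket Z) :
    toEuclideanLin A v = WithLp.toLp 2 (A *ᵥ v.ofLp) := rfl

theorem toEuclideanLin_one_apply (v : Ket Z) : toEuclideanLin (1 : Op Z) v = v := by
  rw [toEuclideanLin_eq_toLp, one_mulVec]

theorem inner_toEuclideanLin (A : Op Z) (v w : Ket Z) :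
    inner ℂ v (toEuclideanLin A w) = inner ℂ (toEuclideanLin Aᴴ v) w := by
  rw [toEuclideanLin_conjTranspose_eq_adjoint, LinearMap.adjoint_inner_left]

theorem toEuclideanLin_mul_apply (A B : Op Z) (v : Ket Z) :
    toEuclideanLin (A * B) v = toEuclideanLin A (toEuclideanLin B v) := by
  simp only [toEuclideanLin_eq_toLp, mulVec_mulVec]

theorem norm_toEuclideanLin_sq (A : Op Z) (v : Ket Z) :
    ((‖toEuclideanLin A v‖ : ℝ) : ℂ) ^ 2 = inner ℂ v (toEuclideanLin (Aᴴ * A) v) := by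
  rw [toEuclideanLin_mul_apply, inner_toEuclideanLin, conjTranspose_conjTranspose,
    inner_self_eq_norm_sq_to_K]
  rfl

theorem norm_toEuclideanLin_of_unitary {V : Op Z} (hV : Vᴴ * V = 1) (v : Ket Z) :
    ‖toEuclideanLin V v‖ = ‖v‖ := by
  have h := norm_toEuclideanLin_sq V v
  rw [hV, toEuclideanLin_one_apply, inner_self_eq_norm_sq_to_K] at h
  have h' : ‖toEuclideanLin V v‖ ^ 2 = ‖v‖ ^ 2 :=
    Complex.ofReal_injective (by push_cast; exact h)
  exact (sq_eq_sq₀ (norm_nonneg _) (norm_nonneg _)).mp h'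

/-- Every square matrix has a polar decomposition `D = P V`. -/
theorem exists_isPolarUnitary (D : Op Z) : ∃ V, IsPolarUnitary D V := by
  -- `P` is the square root of `D * Dᴴ`. Since `P v` and `Dᴴ v` have equal norms, `P v ↦ Dᴴ v` is a
  -- well-defined isometry on the range of `P`; in finite dimension it extends to a unitary `W`, and
  -- `V = Wᴴ`.
  obtain ⟨P, hP, hPD⟩ := (posSemidef_self_mul_conjTranspose D).exists_sqrt
  have hnorm : ∀ v : Ket Z, ‖toEuclideanLin Dᴴ v‖ = ‖toEuclideanLin P v‖ := fun v => by
    have h1 := norm_toEuclideanLin_sq Dᴴ v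
    have h2 := norm_toEuclideanLin_sq P v
    rw [conjTranspose_conjTranspose, ← hPD] at h1
    rw [hP.1.eq, ← h1] at h2
    have h3 : ‖toEuclideanLin P v‖ ^ 2 = ‖toEuclideanLin Dᴴ v‖ ^ 2 := by exact_mod_cast h2
    exact ((sq_eq_sq₀ (norm_nonneg _) (norm_nonneg _)).mp h3).symm
  have hker : LinearMap.ker (toEuclideanLin P) ≤ LinearMap.ker (toEuclideanLin Dᴴ) := fun v hv => by
    rw [LinearMap.mem_ker] at hv ⊢
    rw [← norm_eq_zero, hnorm, hv, norm_zero]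
  let l₀ : LinearMap.range (toEuclideanLin P) →ₗ[ℂ] Ket Z :=
    (LinearMap.ker (toEuclideanLin P)).liftQ (toEuclideanLin Dᴴ) hker ∘ₗ
      (toEuclideanLin P).quotKerEquivRange.symm.toLinearMap
  have hl₀ : ∀ v, l₀ ⟨toEuclideanLin P v, LinearMap.mem_range_self _ v⟩ = toEuclideanLin Dᴴ v :=
    fun v => by
      simp only [l₀, LinearMap.comp_apply, LinearEquiv.coe_coe]
      rw [LinearMap.quotKerEquivRange_symm_apply_image, Submodule.mkQ_apply,
        Submodule.liftQ_apply]
  let l : LinearMap.range (toEuclideanLin P) →ₗᵢ[ℂ] Ket Z :=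
    ⟨l₀, by
      rintro ⟨_, v, rfl⟩
      rw [hl₀, hnorm]
      rfl⟩
  have hl : ∀ v, l.extend (toEuclideanLin P v) = toEuclideanLin Dᴴ v := fun v => by
    rw [← hl₀ v]
    exact l.extend_apply ⟨toEuclideanLin P v, LinearMap.mem_range_self _ v⟩
  let W : Op Z := toEuclideanLin.symm l.extend.toLinearMap
  have hW : ∀ v, toEuclideanLin W v = l.extend v := fun v => by
    simp only [W, LinearEquiv.apply_symm_apply]
    rfl
  have hWP : W * P = Dᴴ := by
    apply toEuclideanLin.injective
    ext1 v
    rw [toEuclideanLin_mul_apply, hW, hl]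
  have hWW : Wᴴ * W = 1 := by
    apply toEuclideanLin.injective
    refine LinearMap.ext fun v => ext_inner_left ℂ fun w => ?_
    rw [toEuclideanLin_mul_apply, inner_toEuclideanLin, conjTranspose_conjTranspose, hW, hW,
      LinearIsometry.inner_map_map, toEuclideanLin_one_apply]
  refine ⟨Wᴴ, ?_, P, hP, ?_⟩
  · rw [mem_unitaryGroup_iff, star_eq_conjTranspose, conjTranspose_conjTranspose, hWW]
  · rw [← conjTranspose_conjTranspose D, ← hWP, conjTranspose_mul, hP.1.eq]

/-- This is `P² ≤ C P`: with `w` the image of `u` under the square root of `P`, the left side equals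
`⟨w, P w⟩ ≤ C * ‖w‖ ^ 2`. -/
theorem Matrix.PosSemidef.norm_sq_le {P : Op Z} (hP : P.PosSemidef) {C : ℝ}
    (hC : ∀ v : Ket Z, ‖toEuclideanLin P v‖ ≤ C * ‖v‖) (u : Ket Z) :
    ‖toEuclideanLin P u‖ ^ 2 ≤ C * (inner ℂ u (toEuclideanLin P u)).re := by
  obtain ⟨S, hS, rfl⟩ := hP.exists_sqrt
  set w := toEuclideanLin S u with hw
  have h1 : (inner ℂ u (toEuclideanLin (S * S) u)).re = ‖w‖ ^ 2 := by
    have := norm_toEuclideanLin_sq S u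
    rw [hS.1.eq] at this
    rw [← this]
    norm_cast
  have h2 : ((‖toEuclideanLin (S * S) u‖ : ℝ) : ℂ) ^ 2 = inner ℂ w (toEuclideanLin (S * S) w) := by
    have : toEuclideanLin (S * S) u = toEuclideanLin S w := toEuclideanLin_mul_apply S S u
    rw [this, norm_toEuclideanLin_sq, hS.1.eq]
  have h3 : ‖toEuclideanLin (S * S) u‖ ^ 2 = ‖inner ℂ w (toEuclideanLin (S * S) w)‖ := by
    rw [← h2]
    simp
  rw [h1, h3]
  calc ‖inner ℂ w (toEuclideanLin (S * S) w)‖ ≤ ‖w‖ * ‖toEuclideanLin (S * S) w‖ :=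
        norm_inner_le_norm _ _
    _ ≤ ‖w‖ * (C * ‖w‖) := by gcongr; exact hC w
    _ = C * ‖w‖ ^ 2 := by ring

end Polar

/-! ### Almost isometric maps -/

section AlmostIsometry

variable {E F G : Type*} [NormedAddCommGroup E] [InnerProductSpace ℂ E]
  [NormedAddCommGroup F] [InnerProductSpace ℂ F] [NormedAddCommGroup G] [InnerProductSpace ℂ G]
  {ι : Type*} [Fintype ι]

/-- The operator norm is at most the Hilbert–Schmidt norm, by Cauchy–Schwarz on the coordinates. -/
theorem norm_map_sq_le_sum (b : OrthonormalBasis ι ℂ E) (R : E →ₗ[ℂ] G) {ψ : E} (hψ : ‖ψ‖ = 1) :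
    ‖R ψ‖ ^ 2 ≤ ∑ k, ‖R (b k)‖ ^ 2 := by
  have h1 : ‖R ψ‖ ≤ ∑ k, ‖inner ℂ (b k) ψ‖ * ‖R (b k)‖ := by
    conv_lhs => rw [← b.sum_repr' ψ]
    rw [map_sum]
    refine (norm_sum_le _ _).trans (Finset.sum_le_sum fun k _ => ?_)
    rw [map_smul, norm_smul]
  calc ‖R ψ‖ ^ 2 ≤ (∑ k, ‖inner ℂ (b k) ψ‖ * ‖R (b k)‖) ^ 2 := by gcongr
    _ ≤ (∑ k, ‖inner ℂ (b k) ψ‖ ^ 2) * ∑ k, ‖R (b k)‖ ^ 2 := Finset.sum_mul_sq_le_sq_mul_sq _ _ _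
    _ = ∑ k, ‖R (b k)‖ ^ 2 := by rw [b.sum_sq_norm_inner_right, hψ]; simp

/-- The loss of norm of a contraction is controlled by the losses on an orthonormal basis. -/
theorem one_sub_norm_map_sq_le_sum (b : OrthonormalBasis ι ℂ E) {T : E →ₗ[ℂ] F} {R : E →ₗ[ℂ] G}
    (hTR : ∀ ψ, ‖T ψ‖ ^ 2 + ‖R ψ‖ ^ 2 = ‖ψ‖ ^ 2) {ψ : E} (hψ : ‖ψ‖ = 1) :
    1 - ‖T ψ‖ ^ 2 ≤ ∑ k, (1 - ‖T (b k)‖ ^ 2) := by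
  have h1 : ∀ φ : E, ‖φ‖ = 1 → 1 - ‖T φ‖ ^ 2 = ‖R φ‖ ^ 2 := fun φ hφ => by
    have := hTR φ
    rw [hφ] at this
    linarith
  rw [h1 ψ hψ, Finset.sum_congr rfl fun k _ => h1 (b k) (b.norm_eq_one k)]
  exact norm_map_sq_le_sum b R hψ

theorem norm_sum_smul_le (c : ι → ℂ) (e : ι → F) {r δ : ℝ} (hr : 0 ≤ r)
    (hc : ∀ k, ‖c k‖ ≤ r) (he : ∀ k, ‖e k‖ ≤ δ) :
    ‖∑ k, c k • e k‖ ≤ Fintype.card ι * δ * r := by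
  calc ‖∑ k, c k • e k‖ ≤ ∑ k, ‖c k • e k‖ := norm_sum_le _ _
    _ ≤ ∑ _k : ι, r * δ := Finset.sum_le_sum fun k _ => by
        rw [norm_smul]
        exact mul_le_mul (hc k) (he k) (norm_nonneg _) hr
    _ = Fintype.card ι * δ * r := by
        rw [Finset.sum_const, Finset.card_univ, nsmul_eq_mul]; ring

variable {Z : Type*} [Fintype Z] [DecidableEq Z]

/-- If `T` is a contraction that is almost isometric, and `P V` is the polar decomposition of an
operator `D` that maps an orthonormal basis, encoded by `J`, approximately as `T` does, then
`V J` is close to `T`. -/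
theorem norm_inner_sq_ge_of_polar (b : OrthonormalBasis ι ℂ E) {T : E →ₗ[ℂ] Ket Z}
    (hT : ∀ ψ, ‖T ψ‖ ≤ ‖ψ‖) (J : E →ₗᵢ[ℂ] Ket Z) {φ : ι → Ket Z} {δ : ℝ} (hδ : 0 ≤ δ)
    (hφ : ∀ k, ‖φ k - T (b k)‖ ≤ δ) {D P V : Op Z}
    (hD : ∀ w, toEuclideanLin D w = ∑ k, inner ℂ (J (b k)) w • φ k)
    (hP : P.PosSemidef) (hV : V ∈ unitaryGroup Z ℂ) (hDPV : D = P * V)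
    (hsmall : Fintype.card ι * δ ≤ 1 / 6) {ψ : E} (hψ : ‖ψ‖ = 1)
    (hTψ : 1 - Fintype.card ι * δ ≤ ‖T ψ‖ ^ 2) :
    1 - 12 * (Fintype.card ι * δ) ≤ ‖inner ℂ (toEuclideanLin V (J ψ)) (T ψ)‖ ^ 2 := by
  set x : ℝ := Fintype.card ι * δ with hx
  have hx0 : 0 ≤ x := by positivity
  have hVV : Vᴴ * V = 1 := mem_unitaryGroup_iff'.mp hV
  have hVV' : V * Vᴴ = 1 := mem_unitaryGroup_iff.mp hV
  have hJb : Orthonormal ℂ fun k => J (b k) := b.orthonormal.comp_linearIsometry J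
  -- The sum inside `T` is `J†` applied to `w`, so `D` is within `x` of `T J†` in operator norm.
  have hDT : ∀ w, ‖toEuclideanLin D w - T (∑ k, inner ℂ (J (b k)) w • b k)‖ ≤ x * ‖w‖ := fun w => by
    have h1 : toEuclideanLin D w - T (∑ k, inner ℂ (J (b k)) w • b k) =
        ∑ k, inner ℂ (J (b k)) w • (φ k - T (b k)) := by
      rw [hD, map_sum, ← Finset.sum_sub_distrib]
      refine Finset.sum_congr rfl fun k _ => ?_
      rw [map_smul, smul_sub]
    rw [h1, hx]
    refine norm_sum_smul_le _ _ (norm_nonneg w) (fun k => ?_) hφ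
    refine (norm_inner_le_norm _ _).trans ?_
    rw [J.norm_map, b.norm_eq_one, one_mul]
  have hcontr : ∀ w : Ket Z, ‖∑ k, inner ℂ (J (b k)) w • b k‖ ≤ ‖w‖ := fun w => by
    have h1 : ‖∑ k, inner ℂ (J (b k)) w • b k‖ ^ 2 = ∑ k, ‖inner ℂ (J (b k)) w‖ ^ 2 := by
      rw [← b.sum_sq_norm_inner_right]
      refine Finset.sum_congr rfl fun k _ => ?_
      rw [b.orthonormal.inner_right_fintype]
    have h2 : ‖∑ k, inner ℂ (J (b k)) w • b k‖ ^ 2 ≤ ‖w‖ ^ 2 := by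
      rw [h1]
      exact hJb.sum_inner_products_le w
    exact (sq_le_sq₀ (norm_nonneg _) (norm_nonneg _)).mp h2
  have hPnorm : ∀ v : Ket Z, ‖toEuclideanLin P v‖ ≤ (1 + x) * ‖v‖ := fun v => by
    set w := toEuclideanLin Vᴴ v with hw
    have h1 : ‖w‖ = ‖v‖ := norm_toEuclideanLin_of_unitary
      (by rw [conjTranspose_conjTranspose, hVV']) v
    have h2 : toEuclideanLin P v = toEuclideanLin D w := by
      rw [hw, ← toEuclideanLin_mul_apply, hDPV, Matrix.mul_assoc, hVV', Matrix.mul_one]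
    rw [h2, ← h1]
    calc ‖toEuclideanLin D w‖
        ≤ ‖toEuclideanLin D w - T (∑ k, inner ℂ (J (b k)) w • b k)‖ +
            ‖T (∑ k, inner ℂ (J (b k)) w • b k)‖ := norm_le_norm_sub_add _ _
      _ ≤ x * ‖w‖ + ‖w‖ := add_le_add (hDT w) ((hT _).trans (hcontr w))
      _ = (1 + x) * ‖w‖ := by ring
  set u := toEuclideanLin V (J ψ) with hu
  have hunorm : ‖u‖ = 1 := by rw [hu, norm_toEuclideanLin_of_unitary hVV, J.norm_map, hψ]
  have hPu : ‖toEuclideanLin P u - T ψ‖ ≤ x := by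
    have h1 := hDT (J ψ)
    simp only [LinearIsometry.inner_map_map] at h1
    rwa [b.sum_repr', J.norm_map, hψ, mul_one, hDPV, toEuclideanLin_mul_apply] at h1
  have hTle : ‖T ψ‖ ≤ 1 := hψ ▸ hT ψ
  -- As `‖T ψ‖ ≤ 1`, its norm is at least its square, hence at least `1 - x`; replacing `T ψ` by `P
  -- u` costs another `x`.
  have hPu2 : 1 - 2 * x ≤ ‖toEuclideanLin P u‖ := by
    have h1 : ‖T ψ‖ ≤ ‖toEuclideanLin P u‖ + ‖toEuclideanLin P u - T ψ‖ := norm_le_norm_add_norm_sub _ _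
    nlinarith [norm_nonneg (T ψ)]
  have hr := hP.norm_sq_le hPnorm u
  set r := (inner ℂ u (toEuclideanLin P u)).re
  -- From `(1 - 2x)² ≤ (1 + x) r` and `(1 - 5x)(1 + x) ≤ (1 - 2x)²`. Passing back to `T ψ` gives `1
  -- - 6x`, nonnegative by `hsmall`, and squaring gives `1 - 12x`.
  have hr' : 1 - 5 * x ≤ r := by
    by_contra! hlt
    have h1 : (1 - 2 * x) ^ 2 ≤ ‖toEuclideanLin P u‖ ^ 2 := by gcongr; linarith
    nlinarith
  have hre : r - x ≤ (inner ℂ u (T ψ)).re := by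
    have h1 : inner ℂ u (T ψ) = inner ℂ u (toEuclideanLin P u) -
        inner ℂ u (toEuclideanLin P u - T ψ) := by rw [inner_sub_right]; ring
    have h2 : (inner ℂ u (toEuclideanLin P u - T ψ)).re ≤ x := by
      refine (Complex.re_le_norm _).trans ((norm_inner_le_norm _ _).trans ?_)
      rwa [hunorm, one_mul]
    rw [h1, Complex.sub_re]
    linarith
  have hfin : 1 - 6 * x ≤ ‖inner ℂ u (T ψ)‖ := by
    have := Complex.re_le_norm (inner ℂ u (T ψ))
    linarith
  calc 1 - 12 * x ≤ (1 - 6 * x) ^ 2 := by nlinarith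
    _ ≤ ‖inner ℂ u (T ψ)‖ ^ 2 := by gcongr; linarith

end AlmostIsometry

/-! ### Fidelities -/

section Fidelity

section PartialTrace

variable {A B : Type*} [Fintype A] [Fintype B]

theorem expectation_ketBra (s v : Ket A) :
    expectation (ketBra s s) v = ((‖inner ℂ v s‖ ^ 2 : ℝ) : ℂ) := by
  have h1 : inner ℂ v s = star v.ofLp ⬝ᵥ s.ofLp := by
    rw [EuclideanSpace.inner_eq_star_dotProduct, dotProduct_comm]
  have h2 : star s.ofLp ⬝ᵥ v.ofLp = star (inner ℂ v s) := by
    rw [h1, ← star_dotProduct]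
  rw [expectation, ketBra, vecMulVec_mulVec, op_smul_eq_smul, dotProduct_smul, h2, ← h1,
    smul_eq_mul, RCLike.star_def, Complex.conj_mul']
  norm_cast

/-- The partial trace of a pure state is a sum of rank-one terms over the traced basis; the others
being nonnegative, one term may be kept alone. -/
theorem norm_inner_sq_le_expectation_traceLeft (s : Ket (A × B)) (v : Ket B) (a : A) :
    ‖inner ℂ v (WithLp.toLp 2 fun j => s (a, j))‖ ^ 2 ≤
      (expectation (traceLeft (ketBra s s)) v).re := by
  have h1 : traceLeft (ketBra s s) = ∑ a, ketBra (WithLp.toLp 2 fun j => s (a, j))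
      (WithLp.toLp 2 fun j => s (a, j)) := by
    ext i j
    simp [traceLeft, Matrix.sum_apply, ketBra_apply]
  have h2 : expectation (traceLeft (ketBra s s)) v =
      ∑ a, ((‖inner ℂ v (WithLp.toLp 2 fun j => s (a, j))‖ ^ 2 : ℝ) : ℂ) := by
    rw [h1, expectation, sum_mulVec, dotProduct_sum]
    exact Finset.sum_congr rfl fun a _ => expectation_ketBra _ v
  rw [h2, ← Complex.ofReal_sum, Complex.ofReal_re]
  exact Finset.single_le_sum
    (f := fun a => ‖inner ℂ v (WithLp.toLp 2 fun j => s (a, j))‖ ^ 2)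
    (fun _ _ => sq_nonneg _) (Finset.mem_univ a)

theorem norm_inner_sq_le_expectation_traceRight (s : Ket (A × B)) (v : Ket A) (i : B) :
    ‖inner ℂ v (WithLp.toLp 2 fun a => s (a, i))‖ ^ 2 ≤
      (expectation (traceRight (ketBra s s)) v).re := by
  have h1 : traceRight (ketBra s s) = ∑ i, ketBra (WithLp.toLp 2 fun a => s (a, i))
      (WithLp.toLp 2 fun a => s (a, i)) := by
    ext a a'
    simp [traceRight, Matrix.sum_apply, ketBra_apply]
  have h2 : expectation (traceRight (ketBra s s)) v =
      ∑ i, ((‖inner ℂ v (WithLp.toLp 2 fun a => s (a, i))‖ ^ 2 : ℝ) : ℂ) := by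
    rw [h1, expectation, sum_mulVec, dotProduct_sum]
    exact Finset.sum_congr rfl fun i _ => expectation_ketBra _ v
  rw [h2, ← Complex.ofReal_sum, Complex.ofReal_re]
  exact Finset.single_le_sum
    (f := fun i => ‖inner ℂ v (WithLp.toLp 2 fun a => s (a, i))‖ ^ 2)
    (fun _ _ => sq_nonneg _) (Finset.mem_univ i)

theorem ketBra_kronecker_ketBra (v : Ket A) (w : Ket B) :
    ketBra v v ⊗ₖ ketBra w w = ketBra (ketTensor v w) (ketTensor v w) := by
  ext ⟨a, i⟩ ⟨a', i'⟩
  simp only [kroneckerMap_apply, ketBra_apply, ketTensor, star_mul']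
  ring

theorem mul_ketBra_mul_conjTranspose [DecidableEq A] (M : Op A) (v : Ket A) :
    M * ketBra v v * Mᴴ = ketBra (toEuclideanLin M v) (toEuclideanLin M v) := by
  rw [ketBra, mul_vecMulVec, vecMulVec_mul, ketBra, toEuclideanLin_eq_toLp, star_mulVec]

theorem expectation_conjTranspose_mul_mul [DecidableEq A] (M V : Op A) (w : Ket A) :
    expectation (Vᴴ * M * V) w = expectation M (toEuclideanLin V w) := by
  rw [expectation, expectation, toEuclideanLin_eq_toLp, star_mulVec, ← mulVec_mulVec,
    ← mulVec_mulVec, dotProduct_mulVec]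

end PartialTrace

variable {X Y : Type*} [Fintype X] [DecidableEq X] [Zero X] [Fintype Y] [DecidableEq Y] [Zero Y]
  {L : ℕ}

theorem norm_inner_sq_le_readFidelity (U : Op (X × Y))
    (J : Ket (X × Y) →ₗᵢ[ℂ] Ket (Fin L → Y)) (V : Op (Fin L → Y)) (ψ : Ket (X × Y)) :
    ‖inner ℂ (toEuclideanLin V (J ψ)) (transferred L U ψ)‖ ^ 2 ≤ readFidelity U J V ψ := by
  rw [readFidelity, ketBra_kronecker_ketBra, mul_ketBra_mul_conjTranspose,
    expectation_conjTranspose_mul_mul]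
  have h : transferred L U ψ = WithLp.toLp 2 fun m =>
      toEuclideanLin (protocol L U) (ketTensor ψ (ketZero (Fin L → Y))) (0, m) := by
    simp only [transferred, toEuclideanLin_eq_toLp]
  rw [h]
  exact norm_inner_sq_le_expectation_traceLeft _ (toEuclideanLin V (J ψ)) (0 : X × Y)

/-- The amplitude of `W†` from `|0⟩ ⊗ V J ψ` to `ψ ⊗ |0⟩` is the conjugate of the reading amplitude,
so writing obeys the same lower bound as reading. -/
theorem norm_inner_sq_le_writeFidelity (U : Op (X × Y))
    (J : Ket (X × Y) →ₗᵢ[ℂ] Ket (Fin L → Y)) (V : Op (Fin L → Y)) (ψ : Ket (X × Y)) :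
    ‖inner ℂ (toEuclideanLin V (J ψ)) (transferred L U ψ)‖ ^ 2 ≤ writeFidelity U J V ψ := by
  rw [writeFidelity, mul_ketBra_mul_conjTranspose V, ketBra_kronecker_ketBra]
  conv_rhs => rw [← conjTranspose_conjTranspose (protocol L U)]
  rw [conjTranspose_conjTranspose (protocol L U)ᴴ, mul_ketBra_mul_conjTranspose]
  set u := toEuclideanLin V (J ψ)
  set s := toEuclideanLin (protocol L U)ᴴ (ketTensor (ketZero (X × Y)) u) with hs
  refine le_trans (le_of_eq ?_) (norm_inner_sq_le_expectation_traceRight s ψ 0)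
  have h1 : inner ℂ ψ (WithLp.toLp 2 fun p => s (p, 0)) =
      inner ℂ (ketTensor ψ (ketZero (Fin L → Y))) s := by
    simp [PiLp.inner_apply, Fintype.sum_prod_type_right, ketTensor, ketZero_apply, apply_ite]
  have h2 : inner ℂ (ketTensor ψ (ketZero (Fin L → Y))) s = inner ℂ (transferred L U ψ) u := by
    rw [hs, inner_toEuclideanLin, conjTranspose_conjTranspose]
    rw [PiLp.inner_apply, PiLp.inner_apply, Fintype.sum_prod_type, Finset.sum_eq_single 0]
    · simp only [toEuclideanLin_eq_toLp, transferred, ketTensor, ketZero_apply, if_true, one_mul]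
    · intro p _ hp
      simp [ketTensor, ketZero_apply, hp]
    · simp
  rw [h1, h2, norm_inner_symm]

end Fidelity

/-! ### Bounds on the fidelities -/

section Bounds

theorem norm_ketTensor {A B : Type*} [Fintype A] [Fintype B] (v : Ket A) (w : Ket B) :
    ‖ketTensor v w‖ = ‖v‖ * ‖w‖ := by
  rw [← sq_eq_sq₀ (norm_nonneg _) (by positivity), mul_pow, EuclideanSpace.norm_sq_eq,
    EuclideanSpace.norm_sq_eq, EuclideanSpace.norm_sq_eq, Fintype.sum_prod_type,
    Finset.sum_mul_sum]
  simp only [ketTensor, norm_mul, mul_pow]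

theorem norm_ketZero (A : Type*) [Fintype A] [DecidableEq A] [Zero A] : ‖ketZero A‖ = 1 := by
  simp [ketZero]

variable {X Y : Type*} [Fintype X] [DecidableEq X] [Zero X] [Fintype Y] [DecidableEq Y] [Zero Y]

/-- The component of the final state along `|0⟩` of the system, as a linear map. -/
noncomputable def transferredLin (L : ℕ) (U : Op (X × Y)) : Ket (X × Y) →ₗ[ℂ] Ket (Fin L → Y) where
  toFun := transferred L U
  map_add' ψ φ := by
    ext m
    simp only [transferred, PiLp.add_apply, ← Pi.add_apply, ← mulVec_add]
    congr 2
    ext p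
    simp [ketTensor, add_mul]
  map_smul' c ψ := by
    ext m
    simp only [transferred, PiLp.smul_apply, RingHom.id_apply]
    rw [← Pi.smul_apply c (protocol L U *ᵥ _), ← mulVec_smul]
    congr 2
    ext p
    simp [ketTensor, mul_assoc]

/-- The component of the final state orthogonal to `|0⟩` of the system. -/
noncomputable def residualLin (L : ℕ) (U : Op (X × Y)) :
    Ket (X × Y) →ₗ[ℂ] Ket ((X × Y) × (Fin L → Y)) where
  toFun ψ := WithLp.toLp 2 fun p =>
    if p.1 = 0 then 0 else (protocol L U *ᵥ (ketTensor ψ (ketZero (Fin L → Y))).ofLp) p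
  map_add' ψ φ := by
    ext p
    by_cases hp : p.1 = 0
    · simp [hp]
    · simp only [hp, if_false, PiLp.add_apply, ← Pi.add_apply, ← mulVec_add]
      congr 2
      ext q
      simp [ketTensor, add_mul]
  map_smul' c ψ := by
    ext p
    by_cases hp : p.1 = 0
    · simp [hp]
    · simp only [hp, if_false, PiLp.smul_apply, RingHom.id_apply]
      rw [← Pi.smul_apply c (protocol L U *ᵥ _), ← mulVec_smul]
      congr 2
      ext q
      simp [ketTensor, mul_assoc]

theorem norm_transferredLin_sq_add {U : Op (X × Y)} (hU : Uᴴ * U = 1) (L : ℕ) (ψ : Ket (X × Y)) :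
    ‖transferredLin L U ψ‖ ^ 2 + ‖residualLin L U ψ‖ ^ 2 = ‖ψ‖ ^ 2 := by
  have h1 : ‖toEuclideanLin (protocol L U) (ketTensor ψ (ketZero (Fin L → Y)))‖ = ‖ψ‖ := by
    rw [norm_toEuclideanLin_of_unitary (protocol_conjTranspose_mul_self hU L), norm_ketTensor,
      norm_ketZero, mul_one]
  rw [← h1, EuclideanSpace.norm_sq_eq, EuclideanSpace.norm_sq_eq, EuclideanSpace.norm_sq_eq,
    Fintype.sum_prod_type (α₁ := X × Y), Fintype.sum_prod_type (α₁ := X × Y),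
    ← Finset.add_sum_erase _ _ (Finset.mem_univ (0 : X × Y)),
    ← Finset.add_sum_erase _ _ (Finset.mem_univ (0 : X × Y))]
  have h2 : ∑ m, ‖residualLin L U ψ (0, m)‖ ^ 2 = 0 := by simp [residualLin]
  rw [h2, zero_add]
  congr 1
  refine Finset.sum_congr rfl fun p hp => Finset.sum_congr rfl fun m _ => ?_
  simp only [residualLin, LinearMap.coe_mk, AddHom.coe_mk, if_neg (Finset.ne_of_mem_erase hp)]
  rfl

theorem norm_transferredLin_le {U : Op (X × Y)} (hU : Uᴴ * U = 1) (L : ℕ) (ψ : Ket (X × Y)) :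
    ‖transferredLin L U ψ‖ ≤ ‖ψ‖ := by
  have := norm_transferredLin_sq_add hU L ψ
  refine (sq_le_sq₀ (norm_nonneg _) (norm_nonneg _)).mp ?_
  nlinarith [sq_nonneg ‖residualLin L U ψ‖]

theorem weight_eq_norm_transferredLin_sq (L : ℕ) (U : Op (X × Y)) (ψ : Ket (X × Y)) :
    weight L U ψ = ‖transferredLin L U ψ‖ ^ 2 := rfl

theorem weight_le_one {U : Op (X × Y)} (hU : Uᴴ * U = 1) (L : ℕ) {ψ : Ket (X × Y)}
    (hψ : ‖ψ‖ = 1) : weight L U ψ ≤ 1 := by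
  rw [weight_eq_norm_transferredLin_sq]
  exact pow_le_one₀ (norm_nonneg _) (hψ ▸ norm_transferredLin_le hU L ψ)

theorem minWeight_le (L : ℕ) (U : Op (X × Y)) (b : OrthonormalBasis (X × Y) ℂ (Ket (X × Y)))
    (k : X × Y) : minWeight L U b ≤ weight L U (b k) :=
  ciInf_le (Set.finite_range _).bddBelow k

theorem minWeight_le_one {U : Op (X × Y)} (hU : Uᴴ * U = 1) (L : ℕ)
    (b : OrthonormalBasis (X × Y) ℂ (Ket (X × Y))) : minWeight L U b ≤ 1 :=
  (minWeight_le L U b 0).trans (weight_le_one hU L (b.norm_eq_one 0))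

/-- For weight `r ^ 2` with `r > 0`, normalising moves the vector by `1 - r ≤ 1 - r ^ 2`. At weight
zero both vectors vanish. -/
theorem norm_memoryKet_sub_le {U : Op (X × Y)} (hU : Uᴴ * U = 1) (L : ℕ) {ψ : Ket (X × Y)}
    (hψ : ‖ψ‖ = 1) : ‖memoryKet L U ψ - transferredLin L U ψ‖ ≤ 1 - weight L U ψ := by
  have hw := weight_le_one hU L hψ
  set r := ‖transferred L U ψ‖ with hr
  have hr0 : 0 ≤ r := norm_nonneg _
  have hwr : weight L U ψ = r ^ 2 := rfl
  have hr1 : r ≤ 1 := by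
    rw [hwr] at hw
    nlinarith
  have h1 : memoryKet L U ψ - transferredLin L U ψ =
      ((r⁻¹ - 1 : ℝ) : ℂ) • transferred L U ψ := by
    rw [memoryKet, hwr, Real.sqrt_sq hr0]
    push_cast
    rw [sub_smul, one_smul]
    rfl
  rw [h1, norm_smul, ← hr, hwr, Complex.norm_real, Real.norm_eq_abs]
  rcases hr0.eq_or_lt with h0 | h0
  · rw [← h0]; norm_num
  · have h2 : 0 ≤ r⁻¹ - 1 := sub_nonneg.mpr ((one_le_inv₀ h0).mpr hr1)
    rw [abs_of_nonneg h2, sub_mul, inv_mul_cancel₀ h0.ne', one_mul]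
    nlinarith

theorem toEuclideanLin_codingOp (L : ℕ) (U : Op (X × Y))
    (b : OrthonormalBasis (X × Y) ℂ (Ket (X × Y))) (J : Ket (X × Y) →ₗᵢ[ℂ] Ket (Fin L → Y))
    (w : Ket (Fin L → Y)) :
    toEuclideanLin (codingOp L U b J) w =
      ∑ k, inner ℂ (J (b k)) w • memoryKet L U (b k) := by
  rw [codingOp, map_sum, LinearMap.sum_apply]
  refine Finset.sum_congr rfl fun k _ => ?_
  rw [toEuclideanLin_eq_toLp, ketBra, vecMulVec_mulVec, op_smul_eq_smul,
    EuclideanSpace.inner_eq_star_dotProduct, dotProduct_comm]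
  rfl

/-- Both fidelities are bounded below in terms of the minimal transferred weight. -/
theorem fidelity_ge {U : Op (X × Y)} (hU : Uᴴ * U = 1) {L : ℕ}
    (b : OrthonormalBasis (X × Y) ℂ (Ket (X × Y))) (J : Ket (X × Y) →ₗᵢ[ℂ] Ket (Fin L → Y))
    {V : Op (Fin L → Y)} (hV : IsPolarUnitary (codingOp L U b J) V) {ψ : Ket (X × Y)}
    (hψ : ‖ψ‖ = 1) :
    minWeight L U b - 10 * Fintype.card (X × Y) * (1 - minWeight L U b) ^ (1 / 4 : ℝ) ≤
        readFidelity U J V ψ ∧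
      minWeight L U b - 10 * Fintype.card (X × Y) * (1 - minWeight L U b) ^ (1 / 4 : ℝ) ≤
        writeFidelity U J V ψ := by
  suffices h : minWeight L U b -
      10 * Fintype.card (X × Y) * (1 - minWeight L U b) ^ (1 / 4 : ℝ) ≤
      ‖inner ℂ (toEuclideanLin V (J ψ)) (transferred L U ψ)‖ ^ 2 from
    ⟨h.trans (norm_inner_sq_le_readFidelity U J V ψ),
      h.trans (norm_inner_sq_le_writeFidelity U J V ψ)⟩
  set η := minWeight L U b with hη
  have hη1 : η ≤ 1 := minWeight_le_one hU L b
  have hδ : 0 ≤ 1 - η := by linarith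
  set q : ℝ := (1 - η) ^ (1 / 4 : ℝ) with hq
  have hq0 : 0 ≤ q := Real.rpow_nonneg hδ _
  have hq4 : q ^ 4 = 1 - η := by
    rw [hq, ← Real.rpow_natCast, ← Real.rpow_mul hδ]
    norm_num
  set d : ℝ := (Fintype.card (X × Y) : ℝ) with hd
  have hd1 : 1 ≤ d := by
    have : 0 < Fintype.card (X × Y) := Fintype.card_pos_iff.mpr ⟨0⟩
    exact Nat.one_le_cast.mpr this
  -- In the first case the claimed bound is nonpositive. In the second, `d * (1 - η) = d * q * q ^
  -- 3` is tiny compared with `d * q`, so the polar estimate applies and its loss `12 * d * (1 - η)`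
  -- fits well within `10 * d * q`.
  rcases le_or_gt 1 (10 * d * q) with hlarge | hsmall
  · exact le_trans (by linarith) (sq_nonneg _)
  have hq1 : q < 1 / 10 := by nlinarith
  have hq3 : q ^ 3 ≤ 1 / 1000 := by
    calc q ^ 3 ≤ (1 / 10) ^ 3 := by gcongr
      _ = 1 / 1000 := by norm_num
  have hdq : 0 ≤ d * q := by positivity
  have hx : d * (1 - η) = d * q * q ^ 3 := by rw [← hq4]; ring
  have hx' : d * (1 - η) ≤ d * q * (1 / 1000) := by
    rw [hx]; gcongr
  obtain ⟨hVu, P, hP, hDPV⟩ := hV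
  have hTψ : 1 - d * (1 - η) ≤ ‖transferredLin L U ψ‖ ^ 2 := by
    have h1 := one_sub_norm_map_sq_le_sum b (norm_transferredLin_sq_add hU L) hψ
    have h2 : ∑ k, (1 - ‖transferredLin L U (b k)‖ ^ 2) ≤ d * (1 - η) := by
      calc ∑ k, (1 - ‖transferredLin L U (b k)‖ ^ 2) ≤ ∑ _k : X × Y, (1 - η) :=
            Finset.sum_le_sum fun k _ => sub_le_sub_left (minWeight_le L U b k) 1
        _ = d * (1 - η) := by rw [Finset.sum_const, Finset.card_univ, nsmul_eq_mul]
    linarith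
  have hmain := norm_inner_sq_ge_of_polar b (norm_transferredLin_le hU L) J hδ
    (fun k => (norm_memoryKet_sub_le hU L (b.norm_eq_one k)).trans
      (sub_le_sub_left (minWeight_le L U b k) 1))
    (toEuclideanLin_codingOp L U b J) hP hVu hDPV (by rw [← hd]; linarith) hψ hTψ
  refine le_trans ?_ hmain
  rw [← hd]
  linarith

/-- If the reduced map is mixing toward `|0⟩⟨0|`, then the minimal transferred weight tends to `1`,
uniformly in the orthonormal basis. -/
theorem eventually_le_minWeight {U : Op (X × Y)} (hU : Uᴴ * U = 1)
    (hmix : IsMixingToward (reducedMap U) (ketBra (ketZero X) (ketZero X))) {ε : ℝ} (hε : 0 < ε) :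
    ∀ᶠ L in atTop, ∀ b : OrthonormalBasis (X × Y) ℂ (Ket (X × Y)), 1 - ε ≤ minWeight L U b := by
  -- The total loss on one fixed basis bounds the loss of every unit vector, hence the choice of `L`
  -- is uniform over all bases.
  have hlim : Tendsto (fun L => ∑ k, (1 - weight L U (EuclideanSpace.basisFun (X × Y) ℂ k)))
      atTop (𝓝 0) := by
    rw [← Finset.sum_const_zero (s := (Finset.univ : Finset (X × Y)))]
    refine tendsto_finsetSum _ fun k _ => ?_
    simpa using (tendsto_weight hU hmix
      ((EuclideanSpace.basisFun (X × Y) ℂ).norm_eq_one k)).const_sub 1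
  filter_upwards [hlim.eventually_le_const hε] with L hL b
  have : Nonempty (X × Y) := ⟨0⟩
  refine le_ciInf fun k => ?_
  have h1 := one_sub_norm_map_sq_le_sum (EuclideanSpace.basisFun (X × Y) ℂ)
    (norm_transferredLin_sq_add hU L) (b.norm_eq_one k)
  simp only [← weight_eq_norm_transferredLin_sq] at h1
  linarith

theorem exists_linearIsometry_of_card_le {A B : Type*} [Fintype A] [Fintype B]
    (h : Fintype.card A ≤ Fintype.card B) : Nonempty (Ket A →ₗᵢ[ℂ] Ket B) := by
  classical
  obtain ⟨f⟩ := Function.Embedding.nonempty_of_card_le h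
  let e := EuclideanSpace.basisFun A ℂ
  let l : Ket A →ₗ[ℂ] Ket B := e.toBasis.constr ℂ fun a => EuclideanSpace.basisFun B ℂ (f a)
  have hl : l ∘ e.toBasis = EuclideanSpace.basisFun B ℂ ∘ f := by
    funext a
    simp [l]
  exact ⟨l.isometryOfOrthonormal (v := e.toBasis) (by simp [e])
    (by rw [hl]; exact (EuclideanSpace.basisFun B ℂ).orthonormal.comp f f.injective)⟩

end Bounds

/-! ### Spin chains -/

section SplitChain

variable {a b : ℕ}

theorem excitations_append (x : Cfg a) (y : Cfg b) :
    excitations (Fin.append x y) = excitations x + excitations y := by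
  simp [excitations, Fin.sum_univ_add]

theorem splitEvolution_eq_submatrix (H : Op (Cfg (a + b))) (t : ℝ) :
    splitEvolution a b H t =
      (evolution H t).submatrix (Fin.appendEquiv a b) (Fin.appendEquiv a b) := rfl

theorem splitEvolution_conjTranspose_mul_self {H : Op (Cfg (a + b))} (hH : H.IsHermitian) (t : ℝ) :
    (splitEvolution a b H t)ᴴ * splitEvolution a b H t = 1 := by
  rw [splitEvolution_eq_submatrix, conjTranspose_submatrix, submatrix_mul_equiv,
    star_evolution_mul_self hH, submatrix_one_equiv]

/-- The reduced map of a chain with non-resonant evolution, along which an excitation can travel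
from one end to the other, is mixing. -/
theorem isMixingToward_splitEvolution (hb : 0 < b) {H : Op (Cfg (a + b))} (hH : H.IsHermitian)
    (hnn : IsNearestNeighbour H) (hcons : Commute H (numberOp (a + b)))
    (hhop : ∀ l m : Fin (a + b), (l : ℕ) + 1 = m → H (oneExcitation m) (oneExcitation l) ≠ 0)
    {t : ℝ} (ht : NonResonant H t) :
    IsMixingToward (reducedMap (splitEvolution a b H t))
      (ketBra (ketZero (Cfg a)) (ketZero (Cfg a))) := by
  refine isMixingToward_reducedMap (splitEvolution_conjTranspose_mul_self hH t)
    (n := excitations) (m := excitations) (fun _ => excitations_eq_zero_iff)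
    (fun _ => excitations_eq_zero_iff) (fun x y x' y' h => ?_) fun v μ hv x hx => ?_
  · refine apply_eq_zero_of_excitations_ne (hcons.evolution_left t) ?_
    rwa [excitations_append, excitations_append]
  -- `w` is `|v⟩ ⊗ |0⟩` seen on the whole chain. It vanishes whenever one of the last `b` qubits is
  -- excited, which starts the propagation of zeros along the chain.
  · let w : Cfg (a + b) → ℂ := fun z =>
      v (fun i => z (Fin.castAdd b i)) * if (fun i => z (Fin.natAdd a i)) = 0 then 1 else 0
    have hw : w ∘ Fin.appendEquiv a b = fun p => v p.1 * if p.2 = 0 then 1 else 0 := by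
      funext p
      simp [w, Fin.appendEquiv]
    have hwμ : evolution H t *ᵥ w = μ • w := by
      have h1 : (splitEvolution a b H t) *ᵥ (w ∘ Fin.appendEquiv a b) =
          (evolution H t *ᵥ w) ∘ Fin.appendEquiv a b := by
        rw [splitEvolution_eq_submatrix, submatrix_mulVec_equiv, Function.comp_assoc,
          Equiv.self_comp_symm, Function.comp_id]
      rw [hw, hv, ← hw] at h1
      exact ((Fin.appendEquiv a b).surjective.injective_comp_right h1).symm
    obtain ⟨E, hE⟩ := ht.exists_eigenvalue hH hwμ
    have hz := eigenvector_apply_eq_zero hnn hcons hhop hE (a := a) (by omega)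
      (fun y ⟨k, hk, hyk⟩ => ?_) (y := Fin.append x 0) (fun h => hx ?_)
    · have : w (Fin.append x 0) = v x := by
        have := congrFun hw (x, 0)
        simp only [if_true, mul_one] at this
        exact this
      rwa [this] at hz
    · have hne : (fun i => y (Fin.natAdd a i)) ≠ 0 := fun h => hyk <| by
        have := congrFun h ⟨k - a, by omega⟩
        have hi : Fin.natAdd a (⟨k - a, by omega⟩ : Fin b) = k := Fin.ext (by simp; omega)
        rwa [hi] at this
      simp [w, hne]
    · funext i
      have := congrFun h (Fin.castAdd b i)
      simpa using this

end SplitChain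

theorem norm_aliceKet (a r b : ℕ) (ψ : Ket (Cfg a)) : ‖aliceKet a r b ψ‖ = ‖ψ‖ := by
  rw [aliceKet, norm_ketTensor, norm_ketZero, mul_one]
  have h1 : ‖ketTensor ψ (ketZero (Cfg r))‖ = ‖ψ‖ := by rw [norm_ketTensor, norm_ketZero, mul_one]
  rw [← h1, ← sq_eq_sq₀ (norm_nonneg _) (norm_nonneg _), EuclideanSpace.norm_sq_eq,
    EuclideanSpace.norm_sq_eq]
  exact Equiv.sum_comp (Fin.appendEquiv a r).symm
    fun p => ‖ketTensor ψ (ketZero (Cfg r)) p‖ ^ 2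

theorem mainTheorem3 (NA NR NB : ℕ) (hA : 0 < NA) (hB : 0 < NB)
    (H : Op (Cfg (NA + NR + NB))) (hH : H.IsHermitian)
    (hnn : IsNearestNeighbour H)
    (hcons : Commute H (numberOp (NA + NR + NB)))
    (hf : ∃ s : ℝ, transferFunction H ⟨0, by omega⟩ ⟨NA + NR + NB - 1, by omega⟩ s ≠ 0) :
    -- only countably many time intervals are resonant
    {t : ℝ | ¬ NonResonant H t}.Countable ∧
    -- for all others the reduced map on the uncontrolled part is mixing toward `|0⟩⟨0|`
    (∀ t : ℝ, NonResonant H t →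
      IsMixingToward (reducedMap (splitEvolution (NA + NR) NB H t))
        (ketBra (ketZero (Cfg (NA + NR))) (ketZero (Cfg (NA + NR))))) ∧
    -- the coding transformation exists, and with it the fidelities obey the explicit bound
    (∀ (t : ℝ) (L : ℕ)
      (b : OrthonormalBasis (Cfg (NA + NR) × Cfg NB) ℂ (Ket (Cfg (NA + NR) × Cfg NB)))
      (J : Ket (Cfg (NA + NR) × Cfg NB) →ₗᵢ[ℂ] Ket (Fin L → Cfg NB)),
      (∃ V, IsPolarUnitary (codingOp L (splitEvolution (NA + NR) NB H t) b J) V) ∧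
      ∀ V, IsPolarUnitary (codingOp L (splitEvolution (NA + NR) NB H t) b J) V →
        ∀ ψ : Ket (Cfg (NA + NR) × Cfg NB), ‖ψ‖ = 1 →
          minWeight L (splitEvolution (NA + NR) NB H t) b -
              10 * 2 ^ (NA + NR + NB) *
                (1 - minWeight L (splitEvolution (NA + NR) NB H t) b) ^ (1 / 4 : ℝ) ≤
            readFidelity (splitEvolution (NA + NR) NB H t) J V ψ ∧
          minWeight L (splitEvolution (NA + NR) NB H t) b -
              10 * 2 ^ (NA + NR + NB) *
                (1 - minWeight L (splitEvolution (NA + NR) NB H t) b) ^ (1 / 4 : ℝ) ≤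
            writeFidelity (splitEvolution (NA + NR) NB H t) J V ψ) ∧
    -- for a non-resonant time interval, the minimal weight and the fidelities of reading, of
    -- writing and of the transfer of Alice's states tend to `1`, uniformly in the states
    (∀ t : ℝ, NonResonant H t → ∀ ε : ℝ, 0 < ε → ∀ᶠ L : ℕ in atTop,
      Nonempty (Ket (Cfg (NA + NR) × Cfg NB) →ₗᵢ[ℂ] Ket (Fin L → Cfg NB)) ∧
      ∀ (b : OrthonormalBasis (Cfg (NA + NR) × Cfg NB) ℂ (Ket (Cfg (NA + NR) × Cfg NB)))
        (J : Ket (Cfg (NA + NR) × Cfg NB) →ₗᵢ[ℂ] Ket (Fin L → Cfg NB))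
        (V : Op (Fin L → Cfg NB)),
        IsPolarUnitary (codingOp L (splitEvolution (NA + NR) NB H t) b J) V →
          1 - ε ≤ minWeight L (splitEvolution (NA + NR) NB H t) b ∧
          (∀ ψ : Ket (Cfg (NA + NR) × Cfg NB), ‖ψ‖ = 1 →
            1 - ε ≤ readFidelity (splitEvolution (NA + NR) NB H t) J V ψ ∧
            1 - ε ≤ writeFidelity (splitEvolution (NA + NR) NB H t) J V ψ) ∧
          (∀ ψ : Ket (Cfg NA), ‖ψ‖ = 1 →
            1 - ε ≤ readFidelity (splitEvolution (NA + NR) NB H t) J V (aliceKet NA NR NB ψ))) := by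

  have hhop : ∀ l m : Fin (NA + NR + NB), (l : ℕ) + 1 = m →
      H (oneExcitation m) (oneExcitation l) ≠ 0 := fun l m hlm => by
    obtain ⟨s, hs⟩ := hf
    exact hopping_ne_zero hH hnn hcons hs hlm (Fin.le_def.mpr (Nat.zero_le _))
      (Fin.le_def.mpr (by simp only; omega))
  have hU : ∀ t, (splitEvolution (NA + NR) NB H t)ᴴ * splitEvolution (NA + NR) NB H t = 1 :=
    splitEvolution_conjTranspose_mul_self hH
  have hmix := fun t (ht : NonResonant H t) =>
    isMixingToward_splitEvolution (a := NA + NR) hB hH hnn hcons hhop ht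
  have hcard : (Fintype.card (Cfg (NA + NR) × Cfg NB) : ℝ) = 2 ^ (NA + NR + NB) := by
    simp [pow_add]
  refine ⟨countable_setOf_not_nonResonant H, hmix, fun t L b J =>
    ⟨exists_isPolarUnitary _, fun V hV ψ hψ => ?_⟩, fun t ht ε hε => ?_⟩
  · rw [← hcard]
    exact fidelity_ge (hU t) b J hV hψ
  · set d : ℝ := (Fintype.card (Cfg (NA + NR) × Cfg NB) : ℝ)
    -- The total loss `ε' + 10 d ε' ^ (1/4)` is continuous and vanishes at `0`, so a positive `ε'`
    -- keeps it below `ε`.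
    obtain ⟨ε', hε'0, hε'⟩ : ∃ ε' : ℝ, 0 < ε' ∧ ε' + 10 * d * ε' ^ (1 / 4 : ℝ) ≤ ε := by
      have hc : ContinuousAt (fun x : ℝ => x + 10 * d * x ^ (1 / 4 : ℝ)) 0 :=
        continuousAt_id.add (continuousAt_const.mul
          (Real.continuousAt_rpow_const _ _ (Or.inr (by norm_num))))
      have h0 : (0 : ℝ) + 10 * d * (0 : ℝ) ^ (1 / 4 : ℝ) < ε := by
        rw [Real.zero_rpow (by norm_num)]
        simpa using hε
      have h1 := (hc.eventually_lt_const h0).filter_mono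
        (nhdsWithin_le_nhds (s := Set.Ioi (0 : ℝ)))
      obtain ⟨x, hx, hx0⟩ := (h1.and self_mem_nhdsWithin).exists
      exact ⟨x, hx0, hx.le⟩
    filter_upwards [eventually_le_minWeight (hU t) (hmix t ht) hε'0,
      eventually_ge_atTop (NA + NR + NB)] with L hL hLN
    refine ⟨exists_linearIsometry_of_card_le ?_, fun b J V hV => ?_⟩
    -- Each register holds at least one qubit, so `L ≥ N` registers have room for the whole chain.
    · have h1 : NA + NR + NB ≤ NB * L := hLN.trans (Nat.le_mul_of_pos_left L hB)
      simp only [Fintype.card_prod, Fintype.card_fun, Fintype.card_fin]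
      rw [← pow_add, ← pow_mul]
      exact Nat.pow_le_pow_right (by norm_num) h1
    · have hd0 : 0 ≤ d := Nat.cast_nonneg _
      have hη := hL b
      have hη1 := minWeight_le_one (hU t) L b
      have hpow : (1 - minWeight L (splitEvolution (NA + NR) NB H t) b) ^ (1 / 4 : ℝ) ≤
          ε' ^ (1 / 4 : ℝ) := Real.rpow_le_rpow (by linarith) (by linarith) (by norm_num)
      have hpow' := mul_le_mul_of_nonneg_left hpow (by positivity : 0 ≤ 10 * d)
      have hfid : ∀ ψ : Ket (Cfg (NA + NR) × Cfg NB), ‖ψ‖ = 1 →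
          1 - ε ≤ readFidelity (splitEvolution (NA + NR) NB H t) J V ψ ∧
          1 - ε ≤ writeFidelity (splitEvolution (NA + NR) NB H t) J V ψ := fun ψ hψ => by
        have h := fidelity_ge (hU t) b J hV hψ
        exact ⟨le_trans (by linarith) h.1, le_trans (by linarith) h.2⟩
      have hpos : 0 ≤ 10 * d * ε' ^ (1 / 4 : ℝ) := by positivity
      exact ⟨by linarith, hfid, fun ψ hψ => (hfid _ (by rw [norm_aliceKet, hψ])).1⟩
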